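/- Let $d\ge 2$. Let $\mathbb S\subset\mathbb R^d$ be the unit sphere with its Lebesgue surface measure $dS$, and let $\mathcal H$ be the Hilbert space of Herglotz solutions of the Helmholtz equation $\Delta u+u=0$ in $\mathbb R^d$: the functions $$u(x)=(\mathbf I f)(x)=c_d\int_{\mathbb S} f(\xi)e^{ix\cdot\xi}\,dS(\xi),\qquad f\in L_2(\mathbb S),\qquad c_d=\frac{\sqrt\pi}{(2\pi)^{d/2}},$$ with the scalar product for which $\mathbf I:L_2(\mathbb S)\to\mathcal H$ is unitary. Its reproducing kernel is $\kappa_x=\mathbf I(\Psi_x)$, $\Psi_x(\xi)=c_de^{-ix\cdot\xi}$. For a symbol $a\in L_{1,\mathrm{loc}}(\mathbb R^d)$ (complex-valued) put $$F_a(u,v)=\int_{\mathbb R^d}a(x)u(x)\overline{v(x)}\,dx,\qquad u,v\in\mathcal H.$$ If this integral converges absolutely for all $u,v\in\mathcal H$ and $|F_a(u,v)|\le C\|u\|\,\|v\|$ with a constant $C$, the Toeplitz operator $T_a$ on $\mathcal H$ is the bounded operator defined by $(T_au)(x)=F_a(u,\kappa_x)$. A function $\varphi:[0,\infty)\to\mathbb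 R$ that is positive on $(0,\infty)$ is an admissible radial gauge function if $\boldsymbol\varphi(x)=\varphi(|x|)$ is locally integrable on $\mathbb R^d$ and is a tempered distribution (equivalently, $\int\varphi(|x|)(1+|x|)^{-N}dx<\infty$ for some $N$), and if its Fourier transform $\widehat{\boldsymbol\varphi}$ (in the sense of distributions, with $\widehat\psi(\xi)=(2\pi)^{-d/2}\int e^{-ix\cdot\xi}\psi(x)\,dx$) is in the ball $|\xi|<2$ a (radial) function $\widehat{\boldsymbol\varphi}(\xi)=F(|\xi|)$ with $$\int_{\xi'\in\mathbb R^{d-1},\,|\xi'|\le 2}|\widehat{\boldsymbol\varphi}(0,\xi')|\,d\xi'=\int_{\xi'\in\mathbb R^{d-1},\,|\xi'|\le 2}|F(|\xi'|)|\,d\xi'<\infty .$$ Theorem. Let $\varphi$ be an admissible radial gauge function, and let $a\in L_{1,\mathrm{loc}}(\mathbb R^d)$ satisfy $a(x)=o(\varphi(|x|))$ as $|x|\to\infty$, that is, for every $\varepsilon>0$ there is $R_\varepsilon$ with $|a(x)|\le\varepsilon\varphi(|x|)$ for almost all $x$ with $|x|\ge R_\varepsilon$. Then the form $F_a$ is well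 defined and bounded on $\mathcal H$, and the operator $T_a$ is compact on $\mathcal H$. Moreover, let $a_R$ be equal to $a$ for $|x|\le R$ and to $0$ for $|x|>R$. Then, for every $R$, the form $F_{a_R}$ is well defined and bounded on $\mathcal H$ and the operator $T_{a_R}$ is compact; and $\|T_a-T_{a_R}\|\to 0$ as $R\to\infty$. -/

import Mathlib

open MeasureTheory Filter Topology Metric
open scoped ComplexConjugate SchwartzMap

/-- Euclidean space `ℝ^d`. -/
abbrev RSpace (d : ℕ) : Type := EuclideanSpace ℝ (Fin d)

/-- The unit sphere of `ℝ^d`. -/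
abbrev USphere (d : ℕ) : Type := sphere (0 : RSpace d) 1

/-- The Lebesgue surface measure on the unit sphere. -/
noncomputable abbrev sphereMeasure (d : ℕ) : Measure (USphere d) :=
  (volume : Measure (RSpace d)).toSphere

/-- The Hilbert space `L²` of the unit sphere. -/
noncomputable abbrev SphereL2 (d : ℕ) : Type := Lp ℂ 2 (sphereMeasure d)

/-- The normalizing constant `c_d = √π / (2π)^(d/2)`. -/
noncomputable def herglotzConst (d : ℕ) : ℝ :=
  Real.sqrt Real.pi / (2 * Real.pi) ^ ((d : ℝ) / 2)

/-- The plane wave `exp(i x·ξ)`. -/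
noncomputable def planeWave {d : ℕ} (x ξ : RSpace d) : ℂ :=
  Complex.exp (Complex.I * ((inner ℝ x ξ : ℝ) : ℂ))

/-! ### The Herglotz operator and its injectivity -/

lemma continuous_planeWave {d : ℕ} (x : RSpace d) :
    Continuous fun ξ : USphere d => planeWave x (ξ : RSpace d) := by
  unfold planeWave
  fun_prop

lemma norm_planeWave {d : ℕ} (x ξ : RSpace d) : ‖planeWave x ξ‖ = 1 := by
  unfold planeWave
  rw [mul_comm]
  exact Complex.norm_exp_ofReal_mul_I _

lemma SphereL2.integrable {d : ℕ} (f : SphereL2 d) : Integrable f (sphereMeasure d) :=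
  (Lp.memLp f).integrable (by norm_num)

lemma integrable_mul_planeWave {d : ℕ} {f : USphere d → ℂ} (hf : Integrable f (sphereMeasure d))
    (x : RSpace d) :
    Integrable (fun ξ : USphere d => f ξ * planeWave x ξ) (sphereMeasure d) :=
  hf.mul_bdd (c := 1) (continuous_planeWave x).aestronglyMeasurable
    (Eventually.of_forall fun ξ => (norm_planeWave x ξ).le)

/-- The operator `(I f)(x) = c_d ∫ f(ξ) exp(i x·ξ) dS(ξ)`, with `f` in `L²` of the unit sphere. -/
noncomputable def herglotzMap (d : ℕ) : SphereL2 d →ₗ[ℂ] (RSpace d → ℂ) where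
  toFun f x := (herglotzConst d : ℂ) * ∫ ξ : USphere d, f ξ * planeWave x ξ ∂(sphereMeasure d)
  map_add' f g := by
    ext x
    simp only [Pi.add_apply]
    rw [← mul_add, ← integral_add (integrable_mul_planeWave f.integrable x)
      (integrable_mul_planeWave g.integrable x)]
    congr 1
    refine integral_congr_ae ?_
    filter_upwards [Lp.coeFn_add f g] with ξ h
    rw [h, Pi.add_apply, add_mul]
  map_smul' c f := by
    ext x
    simp only [Pi.smul_apply, smul_eq_mul, RingHom.id_apply]
    rw [mul_left_comm c, ← integral_const_mul c (fun ξ : USphere d => f ξ * planeWave x ξ)]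
    congr 1
    refine integral_congr_ae ?_
    filter_upwards [Lp.coeFn_smul c f] with ξ h
    rw [h, Pi.smul_apply, smul_eq_mul, mul_assoc]

lemma herglotzMap_apply {d : ℕ} (f : SphereL2 d) (x : RSpace d) :
    herglotzMap d f x =
      (herglotzConst d : ℂ) * ∫ ξ : USphere d, f ξ * planeWave x ξ ∂(sphereMeasure d) := rfl

lemma ae_zero_of_real_fourier {d : ℕ} {g : USphere d → ℝ} (hg : Integrable g (sphereMeasure d))
    (h : ∀ x : RSpace d, ∫ ξ : USphere d, (g ξ : ℂ) * planeWave x ξ ∂(sphereMeasure d) = 0) :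
    g =ᵐ[sphereMeasure d] 0 := by
  have hm : AEMeasurable g (sphereMeasure d) := hg.aemeasurable
  set p : USphere d → ENNReal := fun ξ => ENNReal.ofReal (g ξ) with hp
  set q : USphere d → ENNReal := fun ξ => ENNReal.ofReal (-g ξ) with hq
  have hpm : AEMeasurable p (sphereMeasure d) := hm.ennreal_ofReal
  have hqm : AEMeasurable q (sphereMeasure d) := hm.neg.ennreal_ofReal
  have hpi : ∫⁻ ξ, p ξ ∂(sphereMeasure d) ≠ ⊤ := hg.lintegral_lt_top.ne
  have hqi : ∫⁻ ξ, q ξ ∂(sphereMeasure d) ≠ ⊤ := hg.neg.lintegral_lt_top.ne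
  have : IsFiniteMeasure ((sphereMeasure d).withDensity p) := isFiniteMeasure_withDensity hpi
  have : IsFiniteMeasure ((sphereMeasure d).withDensity q) := isFiniteMeasure_withDensity hqi
  have hemb : MeasurableEmbedding (Subtype.val : USphere d → RSpace d) :=
    MeasurableEmbedding.subtype_coe isClosed_sphere.measurableSet
  have key : ((sphereMeasure d).withDensity p).map Subtype.val
      = ((sphereMeasure d).withDensity q).map (Subtype.val : USphere d → RSpace d) := by
    refine Measure.ext_of_charFun ?_
    ext x
    rw [charFun_apply, charFun_apply, hemb.integral_map, hemb.integral_map,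
      integral_withDensity_eq_integral_toReal_smul₀ hpm (Eventually.of_forall fun _ => by simp [hp]),
      integral_withDensity_eq_integral_toReal_smul₀ hqm (Eventually.of_forall fun _ => by simp [hq]),
      ← sub_eq_zero, ← integral_sub]
    · rw [← h x]
      refine integral_congr_ae (Eventually.of_forall fun ξ => ?_)
      have e : ((g ξ : ℝ) : ℂ) = ((p ξ).toReal : ℂ) - ((q ξ).toReal : ℂ) := by
        rw [← Complex.ofReal_sub]
        congr 1
        simp only [hp, hq, ENNReal.toReal_ofReal']
        rcases le_total (g ξ) 0 with h0 | h0
        · rw [max_eq_right h0, max_eq_left (by linarith)]; ring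
        · rw [max_eq_left h0, max_eq_right (by linarith)]; ring
      simp only [e, planeWave, Complex.real_smul, real_inner_comm, sub_mul, mul_comm Complex.I]
    · simp_rw [real_inner_comm, mul_comm _ Complex.I, Complex.real_smul]
      exact integrable_mul_planeWave (integrable_toReal_of_lintegral_ne_top hpm hpi).ofReal x
    · simp_rw [real_inner_comm, mul_comm _ Complex.I, Complex.real_smul]
      exact integrable_mul_planeWave (integrable_toReal_of_lintegral_ne_top hqm hqi).ofReal x
  have key2 : (sphereMeasure d).withDensity p = (sphereMeasure d).withDensity q := by
    have := congrArg (Measure.comap (Subtype.val : USphere d → RSpace d)) key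
    rwa [hemb.comap_map, hemb.comap_map] at this
  have hpq := (withDensity_eq_iff hpm hqm hpi).1 key2
  filter_upwards [hpq] with ξ hξ
  simp only [hp, hq] at hξ
  rcases le_total (g ξ) 0 with h0 | h0
  · rw [ENNReal.ofReal_of_nonpos h0, eq_comm, ENNReal.ofReal_eq_zero] at hξ
    exact le_antisymm h0 (neg_nonpos.1 hξ)
  · rw [ENNReal.ofReal_of_nonpos (by linarith : -g ξ ≤ 0), ENNReal.ofReal_eq_zero] at hξ
    exact le_antisymm hξ h0

lemma herglotzConst_pos (d : ℕ) : 0 < herglotzConst d := by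
  unfold herglotzConst
  positivity

lemma conj_planeWave {d : ℕ} (x ξ : RSpace d) : conj (planeWave x ξ) = planeWave (-x) ξ := by
  simp [planeWave, ← Complex.exp_conj]

lemma herglotzMap_injective (d : ℕ) : Function.Injective (herglotzMap d) := by
  rw [← LinearMap.ker_eq_bot, LinearMap.ker_eq_bot']
  intro f hf
  have h1 : ∀ x : RSpace d, ∫ ξ : USphere d, f ξ * planeWave x ξ ∂(sphereMeasure d) = 0 := fun x => by
    have h0 : (herglotzConst d : ℂ) *
        ∫ ξ : USphere d, f ξ * planeWave x ξ ∂(sphereMeasure d) = 0 := by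
      rw [← herglotzMap_apply, hf, Pi.zero_apply]
    exact (mul_eq_zero.1 h0).resolve_left (Complex.ofReal_ne_zero.2 (herglotzConst_pos d).ne')
  have h2 : ∀ x : RSpace d, ∫ ξ : USphere d, conj (f ξ) * planeWave x ξ ∂(sphereMeasure d) = 0 := fun x => by
    rw [← map_zero (starRingEnd ℂ), ← h1 (-x), ← integral_conj]
    refine integral_congr_ae (Eventually.of_forall fun ξ => ?_)
    simp only [map_mul, conj_planeWave, neg_neg]
  have hc : Integrable (fun ξ => conj (f ξ)) (sphereMeasure d) := by
    simpa using (Complex.conjCLE.toContinuousLinearMap).integrable_comp f.integrable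
  have hre := ae_zero_of_real_fourier (g := fun ξ => (f ξ).re) f.integrable.re fun x => by
    have e : ∀ ξ, (((f ξ).re : ℝ) : ℂ) * planeWave x ξ
        = (1 / 2) * (f ξ * planeWave x ξ + conj (f ξ) * planeWave x ξ) := fun ξ => by
      rw [Complex.re_eq_add_conj]; ring
    simp_rw [e]
    rw [integral_const_mul, integral_add (integrable_mul_planeWave f.integrable x)
      (integrable_mul_planeWave hc x), h1, h2]
    simp
  have him := ae_zero_of_real_fourier (g := fun ξ => (f ξ).im) f.integrable.im fun x => by
    have e : ∀ ξ, (((f ξ).im : ℝ) : ℂ) * planeWave x ξ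
        = (1 / (2 * Complex.I)) * (f ξ * planeWave x ξ - conj (f ξ) * planeWave x ξ) := fun ξ => by
      rw [Complex.im_eq_sub_conj]; ring
    simp_rw [e]
    rw [integral_const_mul, integral_sub (integrable_mul_planeWave f.integrable x)
      (integrable_mul_planeWave hc x), h1, h2]
    simp
  refine (Lp.eq_zero_iff_ae_eq_zero).2 ?_
  filter_upwards [hre, him] with ξ hr hi
  exact Complex.ext hr hi

/-! ### The Hilbert space of Herglotz solutions -/

/-- The space `ℋ` of Herglotz solutions of the Helmholtz equation `Δu + u = 0` in `ℝ^d`: the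
functions `u = I f` with `f` in `L²` of the unit sphere. -/
def HerglotzSpace (d : ℕ) : Type := LinearMap.range (herglotzMap d)

namespace HerglotzSpace

variable {d : ℕ}

noncomputable instance : AddCommGroup (HerglotzSpace d) :=
  inferInstanceAs (AddCommGroup (LinearMap.range (herglotzMap d)))

noncomputable instance : Module ℂ (HerglotzSpace d) :=
  inferInstanceAs (Module ℂ (LinearMap.range (herglotzMap d)))

/-- Elements of `ℋ` are functions on `ℝ^d`. -/
instance : CoeFun (HerglotzSpace d) fun _ => RSpace d → ℂ :=
  ⟨fun u => Subtype.val (p := fun g => g ∈ LinearMap.range (herglotzMap d)) u⟩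

/-- The operator `I`, as a linear isomorphism of `L²` of the unit sphere onto `ℋ`. -/
noncomputable def I (d : ℕ) : SphereL2 d ≃ₗ[ℂ] HerglotzSpace d :=
  LinearEquiv.ofInjective (herglotzMap d) (herglotzMap_injective d)

/-- The norm of `ℋ` is the one for which `I` is an isometry. -/
noncomputable instance : NormedAddCommGroup (HerglotzSpace d) :=
  NormedAddCommGroup.induced _ _ (I d).symm (I d).symm.injective

/-- The scalar product of `ℋ` is the one for which `I` is unitary. -/
noncomputable instance : InnerProductSpace ℂ (HerglotzSpace d) where
  norm_smul_le c u := by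
    change ‖(I d).symm (c • u)‖ ≤ ‖c‖ * ‖(I d).symm u‖
    rw [map_smul, norm_smul]
  inner u v := inner ℂ ((I d).symm u) ((I d).symm v)
  norm_sq_eq_re_inner u := norm_sq_eq_re_inner (𝕜 := ℂ) ((I d).symm u)
  conj_inner_symm u v := inner_conj_symm ((I d).symm u) ((I d).symm v)
  add_left u v w := by simp only [map_add, inner_add_left]
  smul_left u v c := by simp only [map_smul, inner_smul_left]

lemma isometry_I (d : ℕ) : Isometry (I d) :=
  AddMonoidHomClass.isometry_of_norm _ fun f => by
    change ‖(I d).symm (I d f)‖ = ‖f‖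
    rw [LinearEquiv.symm_apply_apply]

instance : CompleteSpace (HerglotzSpace d) :=
  ((isometry_I d).isUniformInducing.completeSpace_congr (I d).surjective).1 inferInstance

/-- The function `Ψ_x(ξ) = c_d exp(-i x·ξ)` on the unit sphere. -/
noncomputable def kernelDensity (x : RSpace d) : SphereL2 d :=
  MemLp.toLp (fun ξ : USphere d => (herglotzConst d : ℂ) * planeWave (-x) ξ)
    (MemLp.of_bound (((continuous_planeWave (-x)).const_mul _).aestronglyMeasurable)
      (herglotzConst d)
      (Eventually.of_forall fun ξ => by
        rw [norm_mul, norm_planeWave, mul_one, Complex.norm_real,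
          Real.norm_of_nonneg (herglotzConst_pos d).le]))

/-- The reproducing kernel `κ_x = I Ψ_x` of `ℋ`. -/
noncomputable def kernel (x : RSpace d) : HerglotzSpace d := I d (kernelDensity x)

end HerglotzSpace

/-! ### Toeplitz operators with function symbols -/

/-- The sesquilinear form `F_a(u,v) = ∫ a(x) u(x) conj(v(x)) dx` on `ℋ`. -/
noncomputable def toeplitzForm {d : ℕ} (a : RSpace d → ℂ) (u v : HerglotzSpace d) : ℂ :=
  ∫ x, a x * u x * conj (v x)

/-- `F_a` is a well-defined bounded sesquilinear form on `ℋ`: its defining integral converges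
(absolutely) for all `u, v ∈ ℋ`, and `|F_a(u,v)| ≤ C ‖u‖ ‖v‖`. -/
def IsBoundedToeplitzForm {d : ℕ} (a : RSpace d → ℂ) : Prop :=
  (∀ u v : HerglotzSpace d, Integrable fun x => a x * u x * conj (v x)) ∧
    ∃ C : ℝ, ∀ u v : HerglotzSpace d, ‖toeplitzForm a u v‖ ≤ C * ‖u‖ * ‖v‖

/-- `T` is the Toeplitz operator `T_a` with symbol `a`: the form `F_a` is a well-defined bounded
form on `ℋ`, and `(T u)(x) = F_a(u, κ_x)` for all `u ∈ ℋ` and all `x`. -/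
def IsToeplitzOperator {d : ℕ} (a : RSpace d → ℂ)
    (T : HerglotzSpace d →L[ℂ] HerglotzSpace d) : Prop :=
  IsBoundedToeplitzForm a ∧
    ∀ (u : HerglotzSpace d) (x : RSpace d), T u x = toeplitzForm a u (HerglotzSpace.kernel x)

/-- The truncation of the symbol `a` to the ball `|x| ≤ R`. -/
noncomputable def truncatedSymbol {d : ℕ} (a : RSpace d → ℂ) (R : ℝ) : RSpace d → ℂ :=
  (closedBall (0 : RSpace d) R).indicator a

/-! ### Admissible radial gauge functions -/

/-- The Fourier transform `(2π)^(-d/2) ∫ exp(-i x·ξ) ψ(ξ) dξ`. -/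
noncomputable def unitaryFourier {d : ℕ} (ψ : RSpace d → ℂ) (x : RSpace d) : ℂ :=
  (((2 * Real.pi) ^ (-(d : ℝ) / 2) : ℝ) : ℂ) * ∫ ξ, planeWave (-x) ξ * ψ ξ

/-- `φ` is an admissible radial gauge function in dimension `d`: it is positive on the open
half-axis (its value at the single point `0` is immaterial), `φ(|x|)` is locally integrable and
defines a tempered distribution, and the Fourier transform of this distribution is, in the ball
`|ξ| < 2`, a (necessarily radial) function `ξ ↦ F(|ξ|)` which is integrable over the hyperdisk
`{(0, ξ') : ξ' ∈ ℝ^(d-1), |ξ'| ≤ 2}`.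

A positive measure is a tempered distribution exactly when `(1 + |x|)^(-N)` is integrable with
respect to it for some `N`. The distributional Fourier transform is given, as usual, by
`(φ̂, ψ) = (φ, ψ̂)` for Schwartz functions `ψ`. -/
structure IsAdmissibleRadialGauge (d : ℕ) (φ : ℝ → ℝ) : Prop where
  pos : ∀ t, 0 < t → 0 < φ t
  locallyIntegrable : LocallyIntegrable fun x : RSpace d => φ ‖x‖
  tempered : ∃ N : ℕ, Integrable fun x : RSpace d => φ ‖x‖ / (1 + ‖x‖) ^ N
  fourier : ∃ F : ℝ → ℂ, Measurable F ∧
    (∀ ψ : 𝓢(RSpace d, ℂ), tsupport ψ ⊆ ball 0 2 →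
      ∫ x : RSpace d, (φ ‖x‖ : ℂ) * unitaryFourier ψ x = ∫ ξ : RSpace d, F ‖ξ‖ * ψ ξ) ∧
    IntegrableOn (fun ξ' : RSpace (d - 1) => F ‖ξ'‖) (closedBall 0 2)

/-! The heart of the matter is the weighted bound `IsAdmissibleRadialGauge.exists_lintegral_le`: the
integral of `φ(|x|) |u(x)|²` is at most a constant times `‖u‖²`. Formally, expanding both factors of
`|u|²` over the sphere turns the left side into a double integral of `f(ξ) conj (f(η))` against the
Fourier transform of the gauge at `η - ξ`. The Schur test then asks for a uniform bound on the
integral of `|F(|ξ - η|)|` in `η`. When the density lives on a small cap the differences stay well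
inside the ball of radius 2, and surface measure on a cap is comparable to Lebesgue measure on a
disk of dimension `d - 1` in terms of chord length. Integrability of `F` over the hyperdisk is
therefore what the Schur test needs (`exists_lintegral_cap_le`,
`lintegral_Ioo_lt_top_of_integrableOn`). Finitely many caps cover the sphere.

The formal computation is made rigorous by inserting `|β̂|²` for a mollifier `β` at scale `δ`
(`integral_gauge_mul_sphereWave`). One factor makes the gauge integrable, the other becomes an extra
average, and `F` is replaced by averages over balls of radius comparable to `δ`. The Schur bound
survives uniformly in `δ` because averages of `1/|z|` over balls are dominated by the value at the
centre (`exists_lintegral_ballMollify_le`). Positivity of the gauge then allows `δ` to shrink while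
the domain of integration grows (`exists_lintegral_gauge_cap_le`).

Given the weighted bound, the tail `a - a_R` is dominated by `ε φ`, so its form, and hence its
operator, has norm `O(ε)`. A truncated symbol is integrable, and its operator is a norm-convergent
integral of rank-one operators built from the reproducing kernels
(`exists_isCompactOperator_of_integrable`). The operator of `a` is thus a norm limit of compact
operators. -/

/-! ### Polar coordinates and slicing by hyperplanes -/

section Polar

variable {E : Type*} [NormedAddCommGroup E] [NormedSpace ℝ E] [MeasurableSpace E] [BorelSpace E]
  [FiniteDimensional ℝ E] [Nontrivial E] (μ : Measure E) [μ.IsAddHaarMeasure]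

/-- Integration in polar coordinates. -/
lemma lintegral_eq_lintegral_toSphere {g : E → ENNReal} (hg : Measurable g) :
    ∫⁻ x, g x ∂μ = ∫⁻ ξ : sphere (0 : E) 1, ∫⁻ r in Set.Ioi (0 : ℝ),
      ENNReal.ofReal (r ^ (Module.finrank ℝ E - 1)) * g (r • (ξ : E)) ∂volume ∂μ.toSphere := by
  have h0 : MeasurableSet ({0}ᶜ : Set E) := (measurableSet_singleton 0).compl
  have hm : Measurable fun p : sphere (0 : E) 1 × Set.Ioi (0 : ℝ) => g (p.2.1 • p.1.1) := by
    refine hg.comp ?_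
    fun_prop
  calc ∫⁻ x, g x ∂μ = ∫⁻ x in {0}ᶜ, g x ∂μ := by rw [restrict_compl_singleton]
    _ = ∫⁻ x : ({0}ᶜ : Set E), g x ∂(μ.comap Subtype.val) := by
      rw [lintegral_subtype_comap h0]
    _ = ∫⁻ x : ({0}ᶜ : Set E), (fun p : sphere (0 : E) 1 × Set.Ioi (0 : ℝ) => g (p.2.1 • p.1.1))
          (homeomorphUnitSphereProd E x) ∂(μ.comap Subtype.val) := by
      refine lintegral_congr fun x => ?_
      have hx : ‖(x : E)‖ ≠ 0 := norm_ne_zero_iff.2 x.2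
      simp [smul_smul, mul_inv_cancel₀ hx]
    _ = ∫⁻ p, (fun p : sphere (0 : E) 1 × Set.Ioi (0 : ℝ) => g (p.2.1 • p.1.1)) p
          ∂(μ.toSphere.prod (Measure.volumeIoiPow (Module.finrank ℝ E - 1))) :=
      μ.measurePreserving_homeomorphUnitSphereProd.lintegral_comp hm
    _ = _ := by
      rw [lintegral_prod _ hm.aemeasurable]
      refine lintegral_congr fun ξ => ?_
      rw [Measure.volumeIoiPow, lintegral_withDensity_eq_lintegral_mul _ (by fun_prop)
        (by exact hm.comp (by fun_prop : Measurable fun r : Set.Ioi (0 : ℝ) => (ξ, r)))]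
      simp only [Pi.mul_apply]
      rw [lintegral_subtype_comap measurableSet_Ioi fun r : ℝ =>
        ENNReal.ofReal (r ^ (Module.finrank ℝ E - 1)) * g (r • (ξ : E))]

lemma lintegral_fun_norm_eq {h : ℝ → ENNReal} (hh : Measurable h) :
    ∫⁻ x, h ‖x‖ ∂μ = μ.toSphere Set.univ * ∫⁻ r in Set.Ioi (0 : ℝ),
      ENNReal.ofReal (r ^ (Module.finrank ℝ E - 1)) * h r := by
  rw [lintegral_eq_lintegral_toSphere μ (g := fun x => h ‖x‖) (hh.comp measurable_norm), mul_comm, ← lintegral_const]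
  refine lintegral_congr fun ξ => setLIntegral_congr_fun measurableSet_Ioi fun r hr => ?_
  have : ‖(ξ : E)‖ = 1 := by simp
  simp [norm_smul, this, abs_of_pos (Set.mem_Ioi.1 hr)]

/-- The integral over the sphere, as an integral over the unit ball. -/
lemma lintegral_ball_normalize {h : E → ENNReal} (hh : Measurable h) :
    ∫⁻ x in ball 0 1, h (‖x‖⁻¹ • x) ∂μ =
      (∫⁻ ξ : sphere (0 : E) 1, h ξ ∂μ.toSphere) *
        ∫⁻ r in Set.Ioo (0 : ℝ) 1, ENNReal.ofReal (r ^ (Module.finrank ℝ E - 1)) := by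
  rw [← lintegral_indicator measurableSet_ball, lintegral_eq_lintegral_toSphere μ
    (Measurable.indicator (f := fun x => h (‖x‖⁻¹ • x)) (hh.comp (by fun_prop)) measurableSet_ball), ← lintegral_mul_const (f := fun ξ : sphere (0 : E) 1 => h ξ) _
      (hh.comp measurable_subtype_coe)]
  refine lintegral_congr fun ξ => ?_
  rw [← lintegral_const_mul _ (by fun_prop), ← lintegral_indicator measurableSet_Ioi,
    ← lintegral_indicator measurableSet_Ioo]
  refine lintegral_congr fun r => ?_
  have hξ : ‖(ξ : E)‖ = 1 := by simp
  by_cases hr : 0 < r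
  · by_cases hr1 : r < 1
    · simp [Set.indicator, hr, hr1, norm_smul, hξ, abs_of_pos hr, smul_smul,
        inv_mul_cancel₀ hr.ne', mul_comm]
    · simp [Set.indicator, hr, hr1, norm_smul, hξ, abs_of_pos hr]
  · simp [Set.indicator, hr]

end Polar

lemma lintegral_coord_norm_eq (n : ℕ) {g : ℝ → ℝ → ENNReal} (hg : Measurable (Function.uncurry g)) :
    ∫⁻ x : RSpace (n + 1), g (x 0) ‖x‖ =
      ∫⁻ s : ℝ, ∫⁻ y : RSpace n, g s (Real.sqrt (s ^ 2 + ‖y‖ ^ 2)) := by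
  have e1 := (PiLp.volume_preserving_toLp (Fin (n + 1)))
  have e2 := volume_preserving_piFinSuccAbove (fun _ : Fin (n + 1) => ℝ) 0
  rw [← e1.lintegral_comp (f := fun x : RSpace (n + 1) => g (x 0) ‖x‖)
    (hg.comp (f := fun x : RSpace (n+1) => (x 0, ‖x‖)) (by fun_prop)),
    ← e2.symm.lintegral_comp_emb (MeasurableEquiv.measurableEmbedding _), Measure.volume_eq_prod,
    lintegral_prod _ ?_]
  · refine lintegral_congr fun s => ?_
    rw [← (PiLp.volume_preserving_ofLp (Fin n)).lintegral_comp_emb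
      (MeasurableEquiv.toLp 2 (Fin n → ℝ)).symm.measurableEmbedding]
    refine lintegral_congr fun y => ?_
    congr 1
    rw [EuclideanSpace.norm_eq, EuclideanSpace.norm_sq_eq]
    simp [Fin.sum_univ_succ, MeasurableEquiv.piFinSuccAbove, Fin.insertNthEquiv]
  · refine Measurable.aemeasurable ?_
    refine hg.comp (f := fun p => ((MeasurableEquiv.piFinSuccAbove (fun _ : Fin (n+1) => ℝ) 0).symm p 0, ‖WithLp.toLp 2 ((MeasurableEquiv.piFinSuccAbove (fun _ : Fin (n+1) => ℝ) 0).symm p)‖)) ?_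
    fun_prop

/-! ### Surface integrals over caps in terms of chord length -/

/-- The tangent of an angle, as a function of the length `r` of its chord in the unit circle. -/
noncomputable def tanOfChord (r : ℝ) : ℝ := r * Real.sqrt (1 - r ^ 2 / 4) / (1 - r ^ 2 / 2)

lemma contDiffAt_tanOfChord {r : ℝ} (hr : r ∈ Set.Ioo (-1 : ℝ) 1) : ContDiffAt ℝ 1 tanOfChord r := by
  have h1 : 1 - r ^ 2 / 2 ≠ 0 := by nlinarith [hr.1, hr.2]
  have h2 : 1 - r ^ 2 / 4 ≠ 0 := by nlinarith [hr.1, hr.2]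
  unfold tanOfChord
  fun_prop (disch := assumption)

lemma exists_bound_deriv_tanOfChord :
    ∃ C : ℝ, ∀ r ∈ Set.Icc (0 : ℝ) (1 / 2), ‖deriv tanOfChord r‖ ≤ C := by
  refine isCompact_Icc.exists_bound_of_continuousOn fun r hr => ContinuousAt.continuousWithinAt ?_
  have := contDiffAt_tanOfChord (r := r) ⟨by linarith [hr.1], by linarith [hr.2]⟩
  exact (this.derivWithin (m := 0) (by simp)).continuousAt

lemma tanOfChord_nonneg {r : ℝ} (hr : r ∈ Set.Ioo (0 : ℝ) (1 / 2)) : 0 ≤ tanOfChord r := by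
  have h1 : 0 < 1 - r ^ 2 / 2 := by nlinarith [hr.1, hr.2]
  have := hr.1
  unfold tanOfChord
  positivity

lemma tanOfChord_le {r : ℝ} (hr : r ∈ Set.Ioo (0 : ℝ) (1 / 2)) : tanOfChord r ≤ 2 * r := by
  have h1 : 0 < 1 - r ^ 2 / 2 := by nlinarith [hr.1, hr.2]
  have h2 : Real.sqrt (1 - r ^ 2 / 4) ≤ 1 := Real.sqrt_le_one.2 (by nlinarith [hr.1])
  unfold tanOfChord
  rw [div_le_iff₀ h1]
  nlinarith [hr.1, hr.2, mul_le_mul_of_nonneg_left h2 hr.1.le]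

/-- A chord of length `r` subtends an angle with cosine `1 - r²/2`, so this is `1 + tan² = 1 / cos²`
followed by solving for `r`. -/
lemma sqrt_two_sub_tanOfChord {r : ℝ} (hr : r ∈ Set.Ioo (0 : ℝ) (1 / 2)) :
    Real.sqrt (2 - 2 / Real.sqrt (1 + tanOfChord r ^ 2)) = r := by
  have h1 : 0 < 1 - r ^ 2 / 2 := by nlinarith [hr.1, hr.2]
  have h2 : 0 ≤ 1 - r ^ 2 / 4 := by nlinarith [hr.1, hr.2]
  have h3 : 1 + tanOfChord r ^ 2 = (1 / (1 - r ^ 2 / 2)) ^ 2 := by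
    unfold tanOfChord
    rw [div_pow, mul_pow, Real.sq_sqrt h2, div_pow, one_pow, eq_div_iff (pow_pos h1 2).ne',
      add_mul, div_mul_cancel₀ _ (pow_pos h1 2).ne']
    ring
  rw [h3, Real.sqrt_sq (by positivity), show 2 - 2 / (1 / (1 - r ^ 2 / 2)) = r ^ 2 by field_simp; ring,
    Real.sqrt_sq hr.1.le]

lemma tanOfChord_sqrt_two_sub {v : ℝ} (hv : 0 ≤ v) :
    tanOfChord (Real.sqrt (2 - 2 / Real.sqrt (1 + v ^ 2))) = v := by
  set w := Real.sqrt (1 + v ^ 2) with hw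
  have hw2 : w ^ 2 = 1 + v ^ 2 := Real.sq_sqrt (by positivity)
  have hw1 : 1 ≤ w := Real.one_le_sqrt.2 (by nlinarith)
  have hw0 : 0 < w := by linarith
  have h2 : 2 / w ≤ 2 := by rw [div_le_iff₀ hw0]; linarith
  have h0 : 0 ≤ 2 - 2 / w := by linarith
  unfold tanOfChord
  rw [Real.sq_sqrt h0, ← Real.sqrt_mul h0,
    show (2 - 2 / w) * (1 - (2 - 2 / w) / 4) = (v / w) ^ 2 by
      field_simp
      linear_combination 4 * hw2,
    Real.sqrt_sq (by positivity)]
  field_simp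
  ring

/-- A one-dimensional change of variables, from tangents to chords. -/
lemma exists_lintegral_chord_le (m : ℕ) : ∃ C : NNReal, ∀ H : ℝ → ENNReal, Measurable H →
    ∀ s ∈ Set.Ioo (0 : ℝ) 1,
    ∫⁻ t in Set.Ioi (0 : ℝ), ENNReal.ofReal (t ^ m) *
      (Set.Iio (1 / 2)).indicator H (Real.sqrt (2 - 2 / Real.sqrt (1 + (t / s) ^ 2))) ≤
    C * ∫⁻ r in Set.Ioo (0 : ℝ) (1 / 2), ENNReal.ofReal (r ^ m) * H r := by
  obtain ⟨C, hC⟩ := exists_bound_deriv_tanOfChord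
  -- The substitution is `t = s * tanOfChord r`. Here `C` bounds the derivative and `2 ^ m` comes
  -- from `tanOfChord r ≤ 2 * r`; the powers of `s` are discarded since `s < 1`, which makes the
  -- constant independent of `s`.
  refine ⟨(2 ^ m * C).toNNReal, fun H hH s hs => ?_⟩
  have hs0 := hs.1
  set ρ : ℝ → ℝ := fun t => Real.sqrt (2 - 2 / Real.sqrt (1 + (t / s) ^ 2)) with hρ
  have hρm : Measurable ρ := by fun_prop
  have hinv : ∀ r ∈ Set.Ioo (0 : ℝ) (1 / 2), ρ (s * tanOfChord r) = r := fun r hr => by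
    simp only [hρ]
    rw [mul_div_cancel_left₀ _ hs0.ne', sqrt_two_sub_tanOfChord hr]
  have himg : ∀ t, 0 < t → ρ t < 1 / 2 → t ∈ (fun r => s * tanOfChord r) '' Set.Ioo (0 : ℝ) (1 / 2) := by
    intro t ht htr
    refine ⟨ρ t, ⟨?_, htr⟩, ?_⟩
    · refine Real.sqrt_pos.2 ?_
      have : 1 < Real.sqrt (1 + (t / s) ^ 2) := by
        rw [Real.lt_sqrt (by norm_num)]
        have : 0 < (t / s) ^ 2 := by positivity
        linarith
      rw [sub_pos, div_lt_iff₀ (by linarith)]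
      linarith
    · simp only [hρ]
      rw [tanOfChord_sqrt_two_sub (by positivity)]
      field_simp
  have hder : ∀ r ∈ Set.Ioo (0 : ℝ) (1 / 2), HasDerivWithinAt (fun r => s * tanOfChord r)
      (s * deriv tanOfChord r) (Set.Ioo (0 : ℝ) (1 / 2)) r := fun r hr =>
    (((contDiffAt_tanOfChord ⟨by linarith [hr.1], by linarith [hr.2]⟩).differentiableAt
      (by simp)).hasDerivAt.const_mul s).hasDerivWithinAt
  have hinj : Set.InjOn (fun r => s * tanOfChord r) (Set.Ioo (0 : ℝ) (1 / 2)) :=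
    Set.LeftInvOn.injOn (f₁' := ρ) hinv
  calc _ ≤ ∫⁻ t in {t | 0 < t ∧ ρ t < 1 / 2}, ENNReal.ofReal (t ^ m) * H (ρ t) := by
        have hset : MeasurableSet {t | 0 < t ∧ ρ t < 1 / 2} :=
          (measurableSet_lt measurable_const measurable_id).inter
            (measurableSet_lt hρm measurable_const)
        rw [← lintegral_indicator measurableSet_Ioi, ← lintegral_indicator hset]
        refine lintegral_mono fun t => ?_
        by_cases h1 : 0 < t <;> by_cases h2 : ρ t < 1 / 2 <;>
          simp [Set.indicator, h1, show √(2 - 2 / √(1 + (t / s) ^ 2)) = ρ t from rfl, h2,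
            -one_div]
    _ ≤ ∫⁻ t in (fun r => s * tanOfChord r) '' Set.Ioo (0 : ℝ) (1 / 2),
          ENNReal.ofReal (t ^ m) * H (ρ t) :=
        lintegral_mono_set fun t ht => himg t ht.1 ht.2
    _ = ∫⁻ r in Set.Ioo (0 : ℝ) (1 / 2), ENNReal.ofReal |s * deriv tanOfChord r| *
          (ENNReal.ofReal ((s * tanOfChord r) ^ m) * H (ρ (s * tanOfChord r))) :=
        lintegral_image_eq_lintegral_abs_deriv_mul measurableSet_Ioo hder hinj _
    _ ≤ ∫⁻ r in Set.Ioo (0 : ℝ) (1 / 2), ((2 ^ m * C).toNNReal : ENNReal) *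
          (ENNReal.ofReal (r ^ m) * H r) := by
        refine setLIntegral_mono' measurableSet_Ioo fun r hr => ?_
        rw [hinv r hr, ← mul_assoc, ← mul_assoc]
        refine mul_le_mul_left ?_ _
        have hCr := hC r ⟨hr.1.le, hr.2.le⟩
        have hC0 := (norm_nonneg _).trans hCr
        have h0 := tanOfChord_nonneg hr
        rw [← ENNReal.ofReal, ← ENNReal.ofReal_mul (abs_nonneg _), ← ENNReal.ofReal_mul (by positivity)]
        refine ENNReal.ofReal_le_ofReal ?_
        have e1 : |s * deriv tanOfChord r| ≤ C := by
          rw [abs_mul, abs_of_pos hs0]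
          calc _ ≤ 1 * |deriv tanOfChord r| := by gcongr; exact hs.2.le
            _ ≤ C := by rw [one_mul]; exact hCr
        have e2 : (s * tanOfChord r) ^ m ≤ (2 * r) ^ m := by
          refine pow_le_pow_left₀ (by positivity) ?_ _
          calc s * tanOfChord r ≤ 1 * tanOfChord r := by gcongr; exact hs.2.le
            _ ≤ 2 * r := by rw [one_mul]; exact tanOfChord_le hr
        calc _ ≤ C * (2 * r) ^ m := by gcongr
          _ = 2 ^ m * C * r ^ m := by rw [mul_pow]; ring
    _ = _ := lintegral_const_mul _ (by fun_prop)

/-- Integrals of functions of the distance to a point of the sphere over a cap. -/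
lemma exists_lintegral_cap_le (n : ℕ) (hn : 1 ≤ n) : ∃ C : NNReal, ∀ H : ℝ → ENNReal, Measurable H →
    ∀ ξ : USphere (n + 1),
    ∫⁻ η : USphere (n + 1), (Set.Iio (1 / 2)).indicator H ‖(ξ : RSpace (n + 1)) - η‖
        ∂(sphereMeasure (n + 1)) ≤
      C * ∫⁻ r in Set.Ioo (0 : ℝ) (1 / 2), ENNReal.ofReal (r ^ (n - 1)) * H r := by
  have : Nontrivial (RSpace n) := by
    have : Nonempty (Fin n) := ⟨⟨0, hn⟩⟩
    infer_instance
  obtain ⟨C, hC⟩ := exists_lintegral_chord_le (n - 1)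
  set c := ∫⁻ r in Set.Ioo (0 : ℝ) 1, ENNReal.ofReal (r ^ (Module.finrank ℝ (RSpace (n + 1)) - 1))
    with hc
  have hc0 : c ≠ 0 := by
    rw [hc, ← lintegral_indicator measurableSet_Ioo, Ne, lintegral_eq_zero_iff
      (Measurable.indicator (by fun_prop) measurableSet_Ioo)]
    intro h
    have h1 : ∀ᵐ r : ℝ, r ∉ Set.Ioo (0 : ℝ) 1 := by
      filter_upwards [h] with r hr hr1
      have := pow_pos hr1.1 (Module.finrank ℝ (RSpace (n + 1)) - 1)
      rw [Set.indicator_of_mem hr1, Pi.zero_apply, ENNReal.ofReal_eq_zero] at hr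
      linarith
    have h2 : volume (Set.Ioo (0 : ℝ) 1) = 0 := by
      rw [measure_eq_zero_iff_ae_notMem]; exact h1
    simp at h2
  have hct : c⁻¹ ≠ ⊤ := ENNReal.inv_ne_top.2 hc0
  set A := (volume : Measure (RSpace n)).toSphere Set.univ with hA
  have hAt : A ≠ ⊤ := measure_ne_top _ _
  -- The function on the sphere is extended to the unit ball, constant along rays. This multiplies
  -- its integral by the radial moment `c`; `A` comes from polar coordinates in the slices.
  refine ⟨c⁻¹.toNNReal * (A.toNNReal * C), fun H hH ξ => ?_⟩
  set k : ℝ → ENNReal := (Set.Iio (1 / 2)).indicator H with hk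
  have hkm : Measurable k := hH.indicator measurableSet_Iio
  set J := ∫⁻ r in Set.Ioo (0 : ℝ) (1 / 2), ENNReal.ofReal (r ^ (n - 1)) * H r with hJ
  have hξ : ‖(ξ : RSpace (n + 1))‖ = 1 := by simp
  have hball := lintegral_ball_normalize (volume : Measure (RSpace (n + 1)))
    (h := fun x => k ‖(ξ : RSpace (n + 1)) - x‖) (hkm.comp (by fun_prop))
  have hct' : c ≠ ⊤ := by
    refine ne_top_of_le_ne_top (b := volume (Set.Ioo (0 : ℝ) 1)) (by simp) ?_
    rw [← setLIntegral_one]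
    refine setLIntegral_mono' measurableSet_Ioo fun r hr => ?_
    simpa using pow_le_one₀ hr.1.le hr.2.le
  suffices hmain : ∫⁻ x in ball 0 1, k ‖(ξ : RSpace (n + 1)) - ‖x‖⁻¹ • x‖ ≤ A * (C * J) by
    rw [hball] at hmain
    push_cast
    rw [ENNReal.coe_toNNReal hct, ENNReal.coe_toNNReal hAt, mul_assoc, mul_assoc, mul_comm c⁻¹,
      ← div_eq_mul_inv, ENNReal.le_div_iff_mul_le (Or.inl hc0) (Or.inl hct')]
    exact hmain
  set e0 : RSpace (n + 1) := EuclideanSpace.single 0 1 with he0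
  -- A reflection carrying `ξ` to the first basis vector. The chord from `ξ` to `x / ‖x‖` then
  -- depends only on the first coordinate of `U x` and on the norm.
  set U := Submodule.reflection (Submodule.span ℝ {(ξ : RSpace (n + 1)) - e0})ᗮ with hU
  have hUξ : U ξ = e0 := Submodule.reflection_sub (by simp [he0])
  set g : ℝ → ℝ → ENNReal := fun s ρ => (Set.Iio 1).indicator
    (fun ρ => k (Real.sqrt (2 - 2 * (s / ρ)))) ρ with hg
  have hgm : Measurable (Function.uncurry g) := by
    have : Function.uncurry g = Set.indicator {p : ℝ × ℝ | p.2 < 1}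
        fun p => k (Real.sqrt (2 - 2 * (p.1 / p.2))) := by
      ext p
      simp [hg, Function.uncurry, Set.indicator]
    rw [this]
    exact (hkm.comp (by fun_prop)).indicator (measurableSet_lt measurable_snd measurable_const)
  calc _ = ∫⁻ x : RSpace (n + 1), g ((U x) 0) ‖U x‖ := by
        rw [← lintegral_indicator measurableSet_ball]
        have h0 : ∀ᵐ x : RSpace (n + 1), x ≠ 0 := by
          simp [ae_iff, measure_singleton]
        refine lintegral_congr_ae (h0.mono fun x hx => ?_)
        have hx' : 0 < ‖x‖ := norm_pos_iff.2 hx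
        have hin : (U x) 0 = inner ℝ (ξ : RSpace (n + 1)) x := by
          rw [← U.inner_map_map, hUξ, he0, EuclideanSpace.inner_single_left]
          simp
        have hnorm : ‖(ξ : RSpace (n + 1)) - ‖x‖⁻¹ • x‖ = Real.sqrt (2 - 2 * ((U x) 0 / ‖x‖)) := by
          rw [eq_comm, ← Real.sqrt_sq (norm_nonneg (_ - _)), norm_sub_sq_real, norm_smul, hξ,
            inner_smul_right, ← hin, norm_inv, norm_norm, inv_mul_cancel₀ hx'.ne']
          congr 1
          ring
        by_cases hx1 : ‖x‖ < 1
        · simp [hg, Set.indicator, hx1, hnorm]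
        · simp [hg, Set.indicator, hx1]
    _ = ∫⁻ x : RSpace (n + 1), g (x 0) ‖x‖ :=
        (LinearIsometryEquiv.measurePreserving U).lintegral_comp
          (f := fun x : RSpace (n + 1) => g (x 0) ‖x‖)
          (hgm.comp (f := fun x : RSpace (n+1) => (x 0, ‖x‖)) (by fun_prop))
    _ = ∫⁻ s : ℝ, ∫⁻ y : RSpace n, g s (Real.sqrt (s ^ 2 + ‖y‖ ^ 2)) :=
        lintegral_coord_norm_eq n hgm
    -- A chord shorter than `1/2` forces a positive cosine, hence `s > 0`, and `s ≤ ‖x‖ < 1` in the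
    -- ball. Only slices of unit total length contribute, and within each the tangent of the angle
    -- is `‖y‖ / s`.
    _ ≤ ∫⁻ s : ℝ, (Set.Ioo (0 : ℝ) 1).indicator (fun _ => A * (C * J)) s := by
        refine lintegral_mono fun s => ?_
        by_cases hs : s ∈ Set.Ioo (0 : ℝ) 1
        · rw [Set.indicator_of_mem hs]
          calc _ ≤ ∫⁻ y : RSpace n, k (Real.sqrt (2 - 2 / Real.sqrt (1 + (‖y‖ / s) ^ 2))) := by
                refine lintegral_mono fun y => ?_
                refine (Set.indicator_le_self _ _ _).trans_eq ?_
                congr 3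
                have hs0 := hs.1
                rw [show s ^ 2 + ‖y‖ ^ 2 = s ^ 2 * (1 + (‖y‖ / s) ^ 2) by field_simp,
                  Real.sqrt_mul (by positivity), Real.sqrt_sq hs0.le]
                field_simp
            _ ≤ A * (C * J) := by
                rw [lintegral_fun_norm_eq volume
                  (h := fun t => k (Real.sqrt (2 - 2 / Real.sqrt (1 + (t / s) ^ 2))))
                  (hkm.comp (by fun_prop)), finrank_euclideanSpace_fin]
                gcongr
                exact hC H hH s hs
        · rw [Set.indicator_of_notMem hs, nonpos_iff_eq_zero]
          refine lintegral_eq_zero_of_ae_eq_zero (Eventually.of_forall fun y => ?_)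
          by_contra h
          have h1 : Real.sqrt (s ^ 2 + ‖y‖ ^ 2) < 1 := by
            by_contra h1; exact h (Set.indicator_of_notMem (s := Set.Iio 1) h1 _)
          rw [hg] at h
          simp only [Set.indicator_of_mem (show _ ∈ Set.Iio (1:ℝ) from h1)] at h
          have h2 : Real.sqrt (2 - 2 * (s / Real.sqrt (s ^ 2 + ‖y‖ ^ 2))) < 1 / 2 := by
            by_contra h2; exact h (Set.indicator_of_notMem (s := Set.Iio (1 / 2)) h2 _)
          rw [Real.sqrt_lt' (by norm_num)] at h2
          have h3 : 0 < s / Real.sqrt (s ^ 2 + ‖y‖ ^ 2) := by linarith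
          have h4 : 0 < s := by
            by_contra h4
            exact absurd h3 (not_lt.2 (div_nonpos_of_nonpos_of_nonneg (not_lt.1 h4) (Real.sqrt_nonneg _)))
          refine hs ⟨h4, lt_of_le_of_lt ?_ h1⟩
          exact Real.le_sqrt_of_sq_le (by nlinarith [sq_nonneg ‖y‖])
    _ = A * (C * J) := by simp

/-! ### Averages of radial functions over small balls -/

lemma lintegral_inv_norm_ball_le (n : ℕ) (hn : 1 ≤ n) {ρ : ℝ} (hρ : 0 < ρ) :
    ∫⁻ z in ball (0 : RSpace (n + 1)) ρ, ENNReal.ofReal ‖z‖⁻¹ ≤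
      sphereMeasure (n + 1) Set.univ * ENNReal.ofReal (ρ ^ n) := by
  have h := lintegral_fun_norm_eq (volume : Measure (RSpace (n + 1)))
    (h := (Set.Iio ρ).indicator fun r => ENNReal.ofReal r⁻¹)
    (Measurable.indicator (by fun_prop) measurableSet_Iio)
  have e : ∫⁻ z in ball (0 : RSpace (n + 1)) ρ, ENNReal.ofReal ‖z‖⁻¹ =
      ∫⁻ x : RSpace (n + 1), (Set.Iio ρ).indicator (fun r => ENNReal.ofReal r⁻¹) ‖x‖ := by
    rw [← lintegral_indicator measurableSet_ball]
    refine lintegral_congr fun x => ?_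
    simp [Set.indicator]
  rw [e, h, finrank_euclideanSpace_fin]
  gcongr
  calc _ ≤ ∫⁻ r : ℝ, (Set.Ioo 0 ρ).indicator (fun _ => ENNReal.ofReal (ρ ^ (n - 1))) r := by
        rw [← lintegral_indicator measurableSet_Ioi]
        refine lintegral_mono fun r => ?_
        by_cases h0 : 0 < r
        · by_cases h1 : r < ρ
          · simp only [Set.indicator, Set.mem_Ioi, h0, Set.mem_Iio, h1, Set.mem_Ioo, and_self,
              if_true]
            rw [← ENNReal.ofReal_mul (by positivity)]
            refine ENNReal.ofReal_le_ofReal ?_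
            obtain ⟨m, rfl⟩ : ∃ m, n = m + 1 := ⟨n - 1, by omega⟩
            simp only [add_tsub_cancel_right]
            rw [pow_succ, mul_assoc, mul_inv_cancel₀ h0.ne', mul_one]
            exact pow_le_pow_left₀ h0.le h1.le _
          · simp [Set.indicator, h1]
        · simp [Set.indicator, h0]
    _ = ENNReal.ofReal (ρ ^ n) := by
        rw [lintegral_indicator measurableSet_Ioo, setLIntegral_const, Real.volume_Ioo,
          ← ENNReal.ofReal_mul (by positivity), sub_zero, ← pow_succ, Nat.sub_add_cancel hn]

/-- Averages of `‖z‖⁻¹` over balls are dominated by its value at the centre. -/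
lemma exists_average_inv_norm_le (n : ℕ) (hn : 1 ≤ n) : ∃ C : NNReal, ∀ δ : ℝ, 0 < δ →
    ∀ y : RSpace (n + 1), y ≠ 0 →
    (volume (closedBall (0 : RSpace (n + 1)) δ))⁻¹ *
      ∫⁻ z in ball y (4 * δ), ENNReal.ofReal ‖z‖⁻¹ ≤ C * ENNReal.ofReal ‖y‖⁻¹ := by
  set v := volume (ball (0 : RSpace (n + 1)) 1) with hv
  have hv0 : v ≠ 0 := (measure_ball_pos volume _ one_pos).ne'
  have hvt : v ≠ ⊤ := measure_ball_lt_top.ne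
  set A := sphereMeasure (n + 1) Set.univ with hA
  have hAt : A ≠ ⊤ := measure_ne_top _ _
  -- The first summand serves `8 δ ≤ ‖y‖`, where `‖z‖ ≥ ‖y‖ / 2` on the ball and the volume ratio is
  -- `4 ^ (n + 1)`. The second serves `‖y‖ < 8 δ`, where the ball lies in that of radius `12 δ`
  -- about the origin.
  refine ⟨2 * 4 ^ (n + 1) + v.toNNReal⁻¹ * A.toNNReal * (8 * 12 ^ n), fun δ hδ y hy => ?_⟩
  have hy0 : 0 < ‖y‖ := norm_pos_iff.2 hy
  have hvol : volume (closedBall (0 : RSpace (n + 1)) δ) = ENNReal.ofReal (δ ^ (n + 1)) * v := by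
    rw [Measure.addHaar_closedBall _ _ hδ.le, finrank_euclideanSpace_fin]
  have hδ0 : ENNReal.ofReal (δ ^ (n + 1)) ≠ 0 := by
    simpa using pow_pos hδ (n + 1)
  push_cast
  rw [ENNReal.coe_inv (by simp [ENNReal.toNNReal_eq_zero_iff, hv0, hvt]), ENNReal.coe_toNNReal hvt, ENNReal.coe_toNNReal hAt, add_mul]
  rcases le_or_gt (8 * δ) ‖y‖ with h | h
  · refine le_trans ?_ le_self_add
    calc _ ≤ (volume (closedBall (0 : RSpace (n + 1)) δ))⁻¹ *
          ∫⁻ z in ball y (4 * δ), ENNReal.ofReal (2 * ‖y‖⁻¹) := by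
          gcongr 1
          refine setLIntegral_mono' measurableSet_ball fun z hz => ENNReal.ofReal_le_ofReal ?_
          rw [mem_ball, dist_eq_norm] at hz
          have h1 : ‖y‖ ≤ ‖z‖ + ‖z - y‖ := by
            calc ‖y‖ = ‖z - (z - y)‖ := by congr 1; abel
              _ ≤ _ := norm_sub_le _ _
          have h2 : ‖y‖ / 2 ≤ ‖z‖ := by linarith
          calc ‖z‖⁻¹ ≤ (‖y‖ / 2)⁻¹ := by gcongr
            _ = 2 * ‖y‖⁻¹ := by field_simp
      _ = 2 * 4 ^ (n + 1) * ENNReal.ofReal ‖y‖⁻¹ *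
          ((volume (closedBall (0 : RSpace (n + 1)) δ))⁻¹ * volume (closedBall (0 : RSpace (n + 1)) δ)) := by
          rw [setLIntegral_const, Measure.addHaar_ball _ _ (by positivity), hvol,
            finrank_euclideanSpace_fin, mul_pow, ENNReal.ofReal_mul (by positivity),
            ENNReal.ofReal_mul (by norm_num), ENNReal.ofReal_pow (by norm_num : (0 : ℝ) ≤ 4)]
          norm_num
          ring
      _ = _ := by
          rw [ENNReal.inv_mul_cancel, mul_one]
          · rw [hvol]; exact mul_ne_zero hδ0 hv0
          · exact measure_closedBall_lt_top.ne
  · refine le_trans ?_ le_add_self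
    calc _ ≤ (volume (closedBall (0 : RSpace (n + 1)) δ))⁻¹ *
          ∫⁻ z in ball (0 : RSpace (n + 1)) (12 * δ), ENNReal.ofReal ‖z‖⁻¹ := by
          gcongr 1
          refine lintegral_mono_set (ball_subset_ball' ?_)
          rw [dist_zero_right]
          linarith
      _ ≤ (volume (closedBall (0 : RSpace (n + 1)) δ))⁻¹ * (A * ENNReal.ofReal ((12 * δ) ^ n)) := by
          gcongr
          exact lintegral_inv_norm_ball_le n hn (by positivity)
      _ = v⁻¹ * A * (12 ^ n * ENNReal.ofReal δ⁻¹) := by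
          rw [hvol, ENNReal.mul_inv (Or.inl hδ0) (Or.inr hv0), ← ENNReal.ofReal_inv_of_pos (by positivity),
            show (12 : ENNReal) ^ n = ENNReal.ofReal (12 ^ n) by
              rw [ENNReal.ofReal_pow (by norm_num)]; norm_num,
            ← ENNReal.ofReal_mul (by positivity),
            show (12 : ℝ) ^ n * δ⁻¹ = (δ ^ (n + 1))⁻¹ * (12 * δ) ^ n by
              rw [mul_pow, pow_succ]; field_simp,
            ENNReal.ofReal_mul (by positivity)]
          ring
      _ ≤ v⁻¹ * A * (12 ^ n * (8 * ENNReal.ofReal ‖y‖⁻¹)) := by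
          gcongr
          rw [show (8 : ENNReal) = ENNReal.ofReal 8 by norm_num, ← ENNReal.ofReal_mul (by norm_num)]
          refine ENNReal.ofReal_le_ofReal ?_
          rw [← div_eq_mul_inv, le_div_iff₀ hy0, inv_mul_le_iff₀ hδ]
          linarith
      _ = _ := by ring

/-- The function `G(‖y‖)`, averaged over the balls of radius `4 δ` and normalized by the volume of
the balls of radius `δ`. -/
noncomputable def ballMollify {d : ℕ} (G : ℝ → ENNReal) (δ : ℝ) (z : RSpace d) : ENNReal :=
  (volume (closedBall (0 : RSpace d) δ))⁻¹ * ∫⁻ y in ball z (4 * δ), G ‖y‖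

/-- The reflection exchanging `z` and `w` preserves Lebesgue measure and radial functions. Hence
averages of a radial function are radial. -/
lemma ballMollify_eq_of_norm_eq {d : ℕ} (G : ℝ → ENNReal) (δ : ℝ) {z w : RSpace d}
    (h : ‖z‖ = ‖w‖) : ballMollify G δ z = ballMollify G δ w := by
  set U := Submodule.reflection (Submodule.span ℝ {z - w})ᗮ with hU
  have hUz : U z = w := Submodule.reflection_sub h
  unfold ballMollify
  congr 1
  have := (LinearIsometryEquiv.measurePreserving U).setLIntegral_comp_preimage_emb
    U.toHomeomorph.measurableEmbedding (fun y => G ‖y‖) (ball w (4 * δ))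
  rw [← this, ← hUz]
  simp

lemma measurable_ballMollify {d : ℕ} {G : ℝ → ENNReal} (hG : Measurable G) (δ : ℝ) :
    Measurable fun z : RSpace d => ballMollify G δ z := by
  unfold ballMollify
  refine Measurable.const_mul ?_ _
  have : (fun z : RSpace d => ∫⁻ y in ball z (4 * δ), G ‖y‖) =
      fun z => ∫⁻ y, Set.indicator {p : RSpace d × RSpace d | dist p.2 p.1 < 4 * δ}
        (fun p => G ‖p.2‖) (z, y) := by
    ext z
    rw [← lintegral_indicator measurableSet_ball]
    rfl
  rw [this]
  refine Measurable.lintegral_prod_right' (Measurable.indicator (by fun_prop) ?_)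
  exact measurableSet_lt (by fun_prop) measurable_const

/-- The weight `r ^ (n - 1) dr` is radial integration in dimension `n + 1` against `1/‖z‖`. After
Tonelli the average falls on `1/‖z‖` instead of `G`, where `exists_average_inv_norm_le` absorbs it
uniformly in `δ`. -/
lemma exists_lintegral_ballMollify_le (n : ℕ) (hn : 1 ≤ n) : ∃ C : NNReal,
    ∀ G : ℝ → ENNReal, Measurable G → ∀ δ ∈ Set.Ioc (0 : ℝ) (1 / 8),
    ∀ e : RSpace (n + 1), ‖e‖ = 1 →
    ∫⁻ r in Set.Ioo (0 : ℝ) (1 / 2), ENNReal.ofReal (r ^ (n - 1)) * ballMollify G δ (r • e) ≤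
      C * ∫⁻ r in Set.Ioo (0 : ℝ) 2, ENNReal.ofReal (r ^ (n - 1)) * G r := by
  obtain ⟨C, hC⟩ := exists_average_inv_norm_le n hn
  refine ⟨C, fun G hG δ hδ e he => ?_⟩
  set A := sphereMeasure (n + 1) Set.univ with hA
  have hAt : A ≠ ⊤ := measure_ne_top _ _
  have hA0 : A ≠ 0 := by
    rw [hA, Ne, Measure.measure_univ_eq_zero]
    exact Measure.toSphere_ne_zero _
  have hM : Measurable fun r : ℝ => ballMollify G δ (r • e) :=
    (measurable_ballMollify hG δ).comp (by fun_prop)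
  have hpow : ∀ r : ℝ, 0 < r → ENNReal.ofReal (r ^ n) * ENNReal.ofReal r⁻¹ =
      ENNReal.ofReal (r ^ (n - 1)) := fun r hr => by
    obtain ⟨m, rfl⟩ : ∃ m, n = m + 1 := ⟨n - 1, by omega⟩
    rw [← ENNReal.ofReal_mul (by positivity), pow_succ, mul_assoc, mul_inv_cancel₀ hr.ne', mul_one,
      Nat.add_sub_cancel]
  have polar : ∀ K : ℝ → ENNReal, Measurable K → ∀ R : ℝ,
      A * ∫⁻ r in Set.Ioo (0 : ℝ) R, ENNReal.ofReal (r ^ (n - 1)) * K r =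
        ∫⁻ z in ball (0 : RSpace (n + 1)) R, ENNReal.ofReal ‖z‖⁻¹ * K ‖z‖ := by
    intro K hK R
    have h := lintegral_fun_norm_eq (volume : Measure (RSpace (n + 1)))
      (h := (Set.Iio R).indicator fun r => ENNReal.ofReal r⁻¹ * K r)
      (Measurable.indicator (by fun_prop) measurableSet_Iio)
    rw [finrank_euclideanSpace_fin, Nat.add_sub_cancel] at h
    rw [← lintegral_indicator measurableSet_ball]
    refine Eq.trans ?_ (h.symm.trans ?_)
    · congr 1
      rw [← lintegral_indicator measurableSet_Ioi, ← lintegral_indicator measurableSet_Ioo]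
      refine lintegral_congr fun r => ?_
      by_cases h0 : 0 < r <;> by_cases h1 : r < R <;>
        simp [Set.indicator, h0, h1]
      rw [← mul_assoc, ← hpow r h0, ENNReal.ofReal_inv_of_pos h0]
    · refine lintegral_congr fun x => ?_
      simp [Set.indicator]
  rw [← ENNReal.mul_le_mul_iff_right hA0 hAt, polar _ hM]
  set c := (volume (closedBall (0 : RSpace (n + 1)) δ))⁻¹ with hc
  set I : RSpace (n + 1) → ENNReal :=
    (ball (0 : RSpace (n + 1)) (1 / 2)).indicator fun z => ENNReal.ofReal ‖z‖⁻¹ with hI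
  set J : RSpace (n + 1) × RSpace (n + 1) → ENNReal :=
    Set.indicator {p | dist p.2 p.1 < 4 * δ} fun p => G ‖p.2‖ with hJ
  have hker : Measurable fun p : RSpace (n + 1) × RSpace (n + 1) => I p.1 * J p := by
    refine Measurable.mul ?_ ?_
    · exact (Measurable.indicator (by fun_prop) measurableSet_ball).comp measurable_fst
    · exact Measurable.indicator (by fun_prop) (measurableSet_lt (by fun_prop) measurable_const)
  calc ∫⁻ z in ball (0 : RSpace (n + 1)) (1 / 2), ENNReal.ofReal ‖z‖⁻¹ * ballMollify G δ (‖z‖ • e)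
      = ∫⁻ z, c * ∫⁻ y, I z * J (z, y) := by
        rw [← lintegral_indicator measurableSet_ball]
        refine lintegral_congr fun z => ?_
        have hIt : I z ≠ ⊤ := by
          by_cases hz : z ∈ ball (0 : RSpace (n + 1)) (1 / 2)
          · rw [hI, Set.indicator_of_mem hz]; exact ENNReal.ofReal_ne_top
          · rw [hI, Set.indicator_of_notMem hz]; exact ENNReal.zero_ne_top
        have hJz : ∫⁻ y, J (z, y) = ∫⁻ y in ball z (4 * δ), G ‖y‖ := by
          rw [← lintegral_indicator measurableSet_ball]
          rfl
        rw [lintegral_const_mul' _ _ hIt, hJz, mul_left_comm]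
        by_cases hz : z ∈ ball (0 : RSpace (n + 1)) (1 / 2)
        · rw [hI, Set.indicator_of_mem hz, Set.indicator_of_mem hz,
            ballMollify_eq_of_norm_eq G δ (w := z) (by simp [norm_smul, he]), ballMollify]
        · rw [hI, Set.indicator_of_notMem hz, Set.indicator_of_notMem hz, zero_mul]
    _ = c * ∫⁻ y, ∫⁻ z, I z * J (z, y) := by
        rw [lintegral_const_mul _ hker.lintegral_prod_right',
          lintegral_lintegral_swap (f := fun z y => I z * J (z, y)) hker.aemeasurable]
    _ = ∫⁻ y, c * ∫⁻ z, I z * J (z, y) := by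
        rw [lintegral_const_mul _ hker.lintegral_prod_left']
    _ ≤ ∫⁻ y, C * (ball (0 : RSpace (n + 1)) 2).indicator
          (fun y => ENNReal.ofReal ‖y‖⁻¹ * G ‖y‖) y := by
        have h0 : ∀ᵐ y : RSpace (n + 1), y ≠ 0 := by simp [ae_iff, measure_singleton]
        refine lintegral_mono_ae (h0.mono fun y hy => ?_)
        by_cases hy2 : y ∈ ball (0 : RSpace (n + 1)) 2
        · rw [Set.indicator_of_mem hy2, ← mul_assoc]
          calc _ ≤ c * ∫⁻ z, (ball y (4 * δ)).indicator (fun z => ENNReal.ofReal ‖z‖⁻¹) z * G ‖y‖ := by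
                refine mul_le_mul_right (lintegral_mono fun z => ?_) _
                have hiff : dist y z < 4 * δ ↔ dist z y < 4 * δ := by rw [dist_comm]
                by_cases h1 : dist z y < 4 * δ <;> by_cases h2 : ‖z‖ < 1 / 2 <;>
                  simp [hI, hJ, Set.indicator, hiff, h1, h2, -one_div]
            _ = c * (∫⁻ z in ball y (4 * δ), ENNReal.ofReal ‖z‖⁻¹) * G ‖y‖ := by
                rw [lintegral_mul_const _ (Measurable.indicator (by fun_prop) measurableSet_ball),
                  lintegral_indicator measurableSet_ball, mul_assoc]
            _ ≤ _ := by
                exact mul_le_mul_left (hC δ hδ.1 y hy) _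
        · rw [Set.indicator_of_notMem hy2, mul_zero, nonpos_iff_eq_zero]
          refine mul_eq_zero_of_right _ (lintegral_eq_zero_of_ae_eq_zero
            (Eventually.of_forall fun z => ?_))
          by_cases h1 : dist y z < 4 * δ
          -- With `δ ≤ 1/8`, averaging moves points by less than `4 δ ≤ 1/2`, so nothing outside the
          -- ball of radius 2 is reached.
          · have h2 : ¬ ‖z‖ < 1 / 2 := fun h2 => hy2 <| by
              have := dist_triangle y z 0
              rw [dist_zero_right z] at this
              rw [mem_ball]
              linarith [hδ.2]
            simp [hI, h2, -one_div]
          · simp [hJ, h1]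
    _ = A * (C * ∫⁻ r in Set.Ioo (0 : ℝ) 2, ENNReal.ofReal (r ^ (n - 1)) * G r) := by
        rw [lintegral_const_mul _ (Measurable.indicator (by fun_prop) measurableSet_ball),
          lintegral_indicator measurableSet_ball, ← polar G hG, mul_left_comm]

/-- The Schur bound for mollified radial kernels on caps of the sphere. -/
lemma exists_lintegral_cap_ballMollify_le (n : ℕ) (hn : 1 ≤ n) : ∃ C : NNReal,
    ∀ G : ℝ → ENNReal, Measurable G → ∀ δ ∈ Set.Ioc (0 : ℝ) (1 / 8), ∀ ξ : USphere (n + 1),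
    ∫⁻ η in ball ξ (1 / 2), ballMollify G δ ((ξ : RSpace (n + 1)) - (η : RSpace (n + 1))) ∂(sphereMeasure (n + 1)) ≤
      C * ∫⁻ r in Set.Ioo (0 : ℝ) 2, ENNReal.ofReal (r ^ (n - 1)) * G r := by
  obtain ⟨C₁, h₁⟩ := exists_lintegral_cap_le n hn
  obtain ⟨C₂, h₂⟩ := exists_lintegral_ballMollify_le n hn
  refine ⟨C₁ * C₂, fun G hG δ hδ ξ => ?_⟩
  have he : ‖(ξ : RSpace (n + 1))‖ = 1 := by simp
  rw [ENNReal.coe_mul, mul_assoc]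
  refine le_trans ?_ ((h₁ (fun r => ballMollify G δ (r • (ξ : RSpace (n + 1))))
    ((measurable_ballMollify hG δ).comp (by fun_prop)) ξ).trans
    (mul_le_mul_right (h₂ G hG δ hδ ξ he) _))
  rw [← lintegral_indicator measurableSet_ball]
  refine lintegral_mono fun η => ?_
  have hiff : dist η ξ = ‖(ξ : RSpace (n + 1)) - η‖ := by
    rw [dist_comm, Subtype.dist_eq, dist_eq_norm]
  by_cases h : ‖(ξ : RSpace (n + 1)) - η‖ < 1 / 2
  · rw [Set.indicator_of_mem (show η ∈ ball ξ (1 / 2) by rwa [mem_ball, hiff]),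
      Set.indicator_of_mem (Set.mem_Iio.2 h)]
    exact (ballMollify_eq_of_norm_eq G δ (by simp [norm_smul])).le
  · rw [Set.indicator_of_notMem (show η ∉ ball ξ (1 / 2) by rwa [mem_ball, hiff])]
    exact zero_le

/-- The hyperdisk condition in polar coordinates of the hyperplane. For `n = d - 1` the weight `r ^
(n - 1)` is the one produced by caps of the sphere in dimension `d`. -/
lemma lintegral_Ioo_lt_top_of_integrableOn {n : ℕ} (hn : 1 ≤ n) {F : ℝ → ℂ} (hF : Measurable F)
    (hint : IntegrableOn (fun x : RSpace n => F ‖x‖) (closedBall 0 2)) :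
    ∫⁻ r in Set.Ioo (0 : ℝ) 2, ENNReal.ofReal (r ^ (n - 1)) * ‖F r‖ₑ < ⊤ := by
  have : Nontrivial (RSpace n) := by
    have : Nonempty (Fin n) := ⟨⟨0, hn⟩⟩
    infer_instance
  have h := lintegral_fun_norm_eq (volume : Measure (RSpace n))
    (h := (Set.Iio 2).indicator fun r => ‖F r‖ₑ) (hF.enorm.indicator measurableSet_Iio)
  rw [finrank_euclideanSpace_fin] at h
  have h1 : ∫⁻ x : RSpace n, (Set.Iio 2).indicator (fun r => ‖F r‖ₑ) ‖x‖ < ⊤ := by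
    refine lt_of_le_of_lt ?_ hint.2
    rw [← lintegral_indicator measurableSet_closedBall]
    refine lintegral_mono fun x => ?_
    by_cases hx : ‖x‖ < 2
    · simp [Set.indicator, hx, hx.le]
    · simp [Set.indicator, hx]
  rw [h] at h1
  refine lt_of_le_of_lt ?_ (ENNReal.lt_top_of_mul_ne_top_right h1.ne ?_)
  · rw [← lintegral_indicator measurableSet_Ioi, ← lintegral_indicator measurableSet_Ioo]
    refine lintegral_mono fun r => ?_
    by_cases h0 : 0 < r <;> by_cases h1 : r < 2 <;> simp [Set.indicator, h0, h1]
  · rw [Ne, Measure.measure_univ_eq_zero]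
    exact Measure.toSphere_ne_zero _

lemma enorm_ofReal_of_nonneg {r : ℝ} (hr : 0 ≤ r) : ‖(r : ℂ)‖ₑ = ENNReal.ofReal r := by
  rw [← ofReal_norm, Complex.norm_real, Real.norm_of_nonneg hr]

/-! ### Mollifiers and their Fourier transforms -/

/-- A smooth probability density supported in the ball of radius `2 δ` and dominated by the inverse
volume of the ball of radius `δ`. -/
structure IsMollifier {d : ℕ} (δ : ℝ) (β : RSpace d → ℝ) : Prop where
  contDiff : ContDiff ℝ (⊤ : ℕ∞) β
  tsupport_subset : tsupport β ⊆ ball 0 (2 * δ)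
  nonneg : ∀ t, 0 ≤ β t
  integral_eq_one : ∫ t, β t = 1
  le_inv_volume : ∀ t, ENNReal.ofReal (β t) ≤ (volume (closedBall (0 : RSpace d) δ))⁻¹

lemma exists_isMollifier (d : ℕ) {δ : ℝ} (hδ : 0 < δ) : ∃ β : RSpace d → ℝ, IsMollifier δ β := by
  -- The outer radius is strictly below `2 δ` so that the closed support fits in the open ball. The
  -- bump equals 1 on the ball of radius `δ`, whence the bound by the inverse volume after
  -- normalization.
  let b : ContDiffBump (0 : RSpace d) := ⟨δ, 3 / 2 * δ, hδ, by linarith⟩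
  refine ⟨b.normed volume, b.contDiff_normed, (b.tsupport_normed_eq (μ := volume)).trans_subset
    (closedBall_subset_ball (by simp only [b]; linarith)), b.nonneg_normed,
    b.integral_normed, fun t => ?_⟩
  have hv : 0 < volume.real (closedBall (0 : RSpace d) δ) :=
    ENNReal.toReal_pos (measure_closedBall_pos _ _ hδ).ne' measure_closedBall_lt_top.ne
  refine (ENNReal.ofReal_le_ofReal (b.normed_le_div_measure_closedBall_rIn volume t)).trans_eq ?_
  rw [one_div, ENNReal.ofReal_inv_of_pos hv]
  simp [measureReal_def, ENNReal.ofReal_toReal measure_closedBall_lt_top.ne]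

lemma planeWave_add_left {d : ℕ} (x y ξ : RSpace d) :
    planeWave (x + y) ξ = planeWave x ξ * planeWave y ξ := by
  simp only [planeWave, inner_add_left, Complex.ofReal_add, mul_add, Complex.exp_add]

lemma planeWave_add_right {d : ℕ} (x ξ η : RSpace d) :
    planeWave x (ξ + η) = planeWave x ξ * planeWave x η := by
  simp only [planeWave, inner_add_right, Complex.ofReal_add, mul_add, Complex.exp_add]

lemma planeWave_neg_left {d : ℕ} (x ξ : RSpace d) : planeWave (-x) ξ = planeWave x (-ξ) := by
  simp [planeWave]

@[fun_prop]
lemma Continuous.planeWave {d : ℕ} {X : Type*} [TopologicalSpace X] {f g : X → RSpace d}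
    (hf : Continuous f) (hg : Continuous g) : Continuous fun x => _root_.planeWave (f x) (g x) := by
  unfold _root_.planeWave
  fun_prop

@[fun_prop]
lemma Measurable.planeWave {d : ℕ} {X : Type*} [MeasurableSpace X] {f g : X → RSpace d}
    (hf : Measurable f) (hg : Measurable g) : Measurable fun x => _root_.planeWave (f x) (g x) := by
  unfold _root_.planeWave
  fun_prop

/-- The characteristic function of a density, `∫ β(t) exp(-i x·t) dt`. -/
noncomputable def waveTransform {d : ℕ} (β : RSpace d → ℝ) (x : RSpace d) : ℂ :=
  ∫ t, planeWave (-x) t * (β t : ℂ)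

lemma conj_waveTransform {d : ℕ} (β : RSpace d → ℝ) (x : RSpace d) :
    conj (waveTransform β x) = ∫ t, (β t : ℂ) * planeWave x t := by
  rw [waveTransform, ← integral_conj]
  refine integral_congr_ae (Eventually.of_forall fun t => ?_)
  simp only [map_mul, conj_planeWave, neg_neg, Complex.conj_ofReal, mul_comm]

lemma integral_planeWave_translate {d : ℕ} (β : RSpace d → ℝ) (x z : RSpace d) :
    ∫ ξ, planeWave (-x) ξ * (β (ξ - z) : ℂ) = planeWave (-x) z * waveTransform β x := by
  rw [waveTransform, ← integral_const_mul, ← integral_add_right_eq_self _ z]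
  refine integral_congr_ae (Eventually.of_forall fun t => ?_)
  simp only [add_sub_cancel_right, planeWave_add_right]
  ring

namespace IsMollifier

variable {d : ℕ} {δ : ℝ} {β : RSpace d → ℝ}

lemma hasCompactSupport (h : IsMollifier δ β) : HasCompactSupport β :=
  (isCompact_closedBall (0 : RSpace d) (2 * δ)).of_isClosed_subset (isClosed_tsupport β)
    (h.tsupport_subset.trans ball_subset_closedBall)

lemma integrable (h : IsMollifier δ β) : Integrable β :=
  h.contDiff.continuous.integrable_of_hasCompactSupport h.hasCompactSupport

lemma eq_zero_of_le_norm (h : IsMollifier δ β) {t : RSpace d} (ht : 2 * δ ≤ ‖t‖) : β t = 0 := by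
  by_contra h0
  have := h.tsupport_subset (subset_tsupport β h0)
  rw [mem_ball_zero_iff] at this
  linarith

lemma lintegral_eq_one (h : IsMollifier δ β) : ∫⁻ t, ENNReal.ofReal (β t) = 1 := by
  rw [← ofReal_integral_eq_lintegral_ofReal h.integrable (Eventually.of_forall h.nonneg),
    h.integral_eq_one, ENNReal.ofReal_one]

lemma integrable_ofReal (h : IsMollifier δ β) : Integrable fun t => (β t : ℂ) := h.integrable.ofReal

lemma continuous_waveTransform (h : IsMollifier δ β) : Continuous (waveTransform β) := by
  unfold waveTransform
  refine continuous_of_dominated (bound := β) (fun x => ?_) (fun x => ?_) h.integrable ?_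
  · exact ((by fun_prop : Continuous fun t => planeWave (-x) t).aestronglyMeasurable).mul
      h.integrable_ofReal.1
  · exact Eventually.of_forall fun t => by
      simp [norm_planeWave, abs_of_nonneg (h.nonneg t)]
  · exact Eventually.of_forall fun t => by fun_prop

/-- On the support of `β` the phase `x·t` is at most `‖x‖ * (2 * δ)`, so the transform is within
`1/2` of its value 1 at the origin. -/
lemma half_le_norm_waveTransform (h : IsMollifier δ β) {x : RSpace d} (hx : ‖x‖ * (2 * δ) ≤ 1 / 2) :
    1 / 2 ≤ ‖waveTransform β x‖ := by
  have h1 : ‖waveTransform β x - 1‖ ≤ 1 / 2 := by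
    have e : waveTransform β x - 1 = ∫ t, (planeWave (-x) t - 1) * (β t : ℂ) := by
      have e1 : (1 : ℂ) = ∫ t, (β t : ℂ) := by
        rw [integral_complex_ofReal, h.integral_eq_one, Complex.ofReal_one]
      rw [waveTransform, e1, ← integral_sub]
      · refine integral_congr_ae (Eventually.of_forall fun t => ?_)
        simp only [← e1]
        ring
      · exact h.integrable_ofReal.bdd_mul (c := 1)
          (by fun_prop : Continuous fun t => planeWave (-x) t).aestronglyMeasurable
          (Eventually.of_forall fun t => (norm_planeWave _ _).le)
      · exact h.integrable_ofReal
    rw [e]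
    refine (norm_integral_le_integral_norm _).trans ?_
    have e2 : (1 / 2 : ℝ) = ∫ t, 1 / 2 * β t := by
      rw [integral_const_mul, h.integral_eq_one, mul_one]
    rw [e2]
    refine integral_mono_of_nonneg (Eventually.of_forall fun t => norm_nonneg _)
      (h.integrable.const_mul _) (Eventually.of_forall fun t => ?_)
    simp only [norm_mul, Complex.norm_real, Real.norm_of_nonneg (h.nonneg t)]
    by_cases ht : 2 * δ ≤ ‖t‖
    · rw [h.eq_zero_of_le_norm ht]; simp
    · refine mul_le_mul_of_nonneg_right ?_ (h.nonneg t)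
      rw [planeWave]
      refine Real.norm_exp_I_mul_ofReal_sub_one_le.trans ?_
      calc ‖(inner ℝ (-x) t : ℝ)‖ ≤ ‖-x‖ * ‖t‖ := norm_inner_le_norm _ _
        _ ≤ ‖x‖ * (2 * δ) := by rw [norm_neg]; gcongr; exact (not_le.1 ht).le
        _ ≤ 1 / 2 := hx
  have h2 : ‖(1 : ℂ)‖ ≤ ‖waveTransform β x‖ + ‖waveTransform β x - 1‖ := by
    calc ‖(1 : ℂ)‖ = ‖waveTransform β x - (waveTransform β x - 1)‖ := by congr 1; ring
      _ ≤ _ := norm_sub_le _ _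
  rw [norm_one] at h2
  linarith

/-- The translates of a mollifier as Schwartz functions. -/
lemma exists_schwartz (h : IsMollifier δ β) (z : RSpace d) :
    ∃ ψ : 𝓢(RSpace d, ℂ), (∀ ξ, ψ ξ = (β (ξ - z) : ℂ)) ∧ tsupport ψ ⊆ closedBall z (2 * δ) := by
  have hsub : Function.support (fun ξ => (β (ξ - z) : ℂ)) ⊆ closedBall z (2 * δ) := fun ξ hξ => by
    have h1 : β (ξ - z) ≠ 0 := fun h0 => hξ (by simp [h0])
    have := h.tsupport_subset (subset_tsupport β h1)
    rw [mem_ball_zero_iff, ← dist_eq_norm] at this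
    exact this.le
  have hc : tsupport (fun ξ => (β (ξ - z) : ℂ)) ⊆ closedBall z (2 * δ) :=
    closure_minimal hsub isClosed_closedBall
  have hs : ContDiff ℝ (⊤ : ℕ∞) fun ξ => (β (ξ - z) : ℂ) :=
    Complex.ofRealCLM.contDiff.comp (h.contDiff.comp (contDiff_id.sub contDiff_const))
  have hcs : HasCompactSupport fun ξ => (β (ξ - z) : ℂ) :=
    (isCompact_closedBall z (2 * δ)).of_isClosed_subset (isClosed_tsupport _) hc
  exact ⟨hcs.toSchwartzMap hs, fun ξ => rfl, hc⟩

lemma exists_waveTransform_decay (h : IsMollifier δ β) (N : ℕ) :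
    ∃ C : ℝ, ∀ x, (1 + ‖x‖) ^ N * ‖waveTransform β x‖ ≤ C := by
  obtain ⟨ψ, hψ, -⟩ := h.exists_schwartz 0
  set g : 𝓢(RSpace d, ℂ) := SchwartzMap.fourierTransformCLM ℂ ψ with hg
  -- The Fourier transform `g` carries `2π` in the exponent, hence the rescaling.
  have e : ∀ x, waveTransform β x = g ((2 * Real.pi)⁻¹ • x) := fun x => by
    rw [hg, SchwartzMap.fourierTransformCLM_apply, SchwartzMap.fourier_coe, Real.fourier_eq',
      waveTransform]
    refine integral_congr_ae (Eventually.of_forall fun t => ?_)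
    simp only [hψ, sub_zero, smul_eq_mul, planeWave, inner_smul_right, inner_neg_left]
    congr 2
    rw [mul_comm, real_inner_comm]
    congr 2
    field_simp
  refine ⟨(2 * Real.pi) ^ N * (2 ^ N * (Finset.Iic (N, 0)).sup
    (fun m => SchwartzMap.seminorm ℂ m.1 m.2) g), fun x => ?_⟩
  have h1 := SchwartzMap.one_add_le_sup_seminorm_apply (𝕜 := ℂ) (m := (N, 0)) le_rfl le_rfl g
    ((2 * Real.pi)⁻¹ • x)
  rw [norm_iteratedFDeriv_zero, ← e] at h1
  have hpi : 1 ≤ 2 * Real.pi := by linarith [Real.pi_gt_three]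
  have h2 : 1 + ‖x‖ ≤ 2 * Real.pi * (1 + ‖(2 * Real.pi)⁻¹ • x‖) := by
    rw [norm_smul, norm_inv, Real.norm_of_nonneg (by positivity), mul_add, ← mul_assoc,
      mul_inv_cancel₀ (by positivity)]
    linarith
  calc (1 + ‖x‖) ^ N * ‖waveTransform β x‖
      ≤ (2 * Real.pi * (1 + ‖(2 * Real.pi)⁻¹ • x‖)) ^ N * ‖waveTransform β x‖ := by gcongr
    _ = (2 * Real.pi) ^ N * ((1 + ‖(2 * Real.pi)⁻¹ • x‖) ^ N * ‖waveTransform β x‖) := by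
        rw [mul_pow, mul_assoc]
    _ ≤ _ := by gcongr

end IsMollifier

/-! ### The regularized gauge and its Fourier transform -/

namespace IsAdmissibleRadialGauge

variable {d : ℕ} {φ : ℝ → ℝ}

/-- The rapid decay of the transform of `β` beats the polynomial growth allowed by temperedness. -/
lemma integrable_mul_waveTransform (hφ : IsAdmissibleRadialGauge d φ) {δ : ℝ} {β : RSpace d → ℝ} (hβ : IsMollifier δ β) :
    Integrable fun x : RSpace d => (φ ‖x‖ : ℂ) * waveTransform β x := by
  obtain ⟨N, hN⟩ := hφ.tempered
  obtain ⟨C, hC⟩ := hβ.exists_waveTransform_decay N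
  have h := hN.ofReal (𝕜 := ℂ) |>.mul_bdd (c := C)
    (g := fun x => ((1 + ‖x‖ : ℝ) : ℂ) ^ N * waveTransform β x)
    (by
      have := hβ.continuous_waveTransform
      exact Continuous.aestronglyMeasurable (by fun_prop))
    (Eventually.of_forall fun x => by
      rw [norm_mul, norm_pow, Complex.norm_real, Real.norm_of_nonneg (by positivity)]
      exact hC x)
  refine h.congr (Eventually.of_forall fun x => ?_)
  have : ((1 + ‖x‖ : ℝ) : ℂ) ≠ 0 := Complex.ofReal_ne_zero.2 (by positivity)
  simp only [RCLike.ofReal_eq_complex_ofReal]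
  push_cast at this ⊢
  field_simp

end IsAdmissibleRadialGauge

/-- The Fourier transform of the mollified gauge is dominated by averages of the Fourier transform
of the gauge. -/
lemma enorm_integral_gauge_waveTransform_le {d : ℕ} {φ : ℝ → ℝ} {F : ℝ → ℂ}
    (hF : ∀ ψ : 𝓢(RSpace d, ℂ), tsupport ψ ⊆ ball 0 2 →
      ∫ x : RSpace d, (φ ‖x‖ : ℂ) * unitaryFourier ψ x = ∫ ξ : RSpace d, F ‖ξ‖ * ψ ξ)
    {δ : ℝ} {β : RSpace d → ℝ} (hβ : IsMollifier δ β) {z w : RSpace d}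
    (hz : ‖z‖ + 2 * δ < 2) (hzw : dist z w < 2 * δ) :
    ‖∫ x : RSpace d, (φ ‖x‖ : ℂ) * waveTransform β x * planeWave (-x) z‖ₑ ≤
      ENNReal.ofReal ((2 * Real.pi) ^ ((d : ℝ) / 2)) * ballMollify (fun r => ‖F r‖ₑ) δ w := by
  obtain ⟨ψ, hψ, hψs⟩ := hβ.exists_schwartz z
  have h1 := hF ψ (hψs.trans (closedBall_subset_ball' (by rw [dist_zero_right]; linarith)))
  have hpos : 0 < (2 * Real.pi) ^ ((d : ℝ) / 2) := by positivity
  -- Multiplying the transform of `β` by a plane wave translates `β` to `z`. The left side is thus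
  -- the gauge paired with the transform of a test function supported near `z`, up to the unitary
  -- normalization.
  have h2 : ∫ x : RSpace d, (φ ‖x‖ : ℂ) * waveTransform β x * planeWave (-x) z =
      (((2 * Real.pi) ^ ((d : ℝ) / 2) : ℝ) : ℂ) * ∫ ξ : RSpace d, F ‖ξ‖ * ψ ξ := by
    rw [← h1, ← integral_const_mul]
    refine integral_congr_ae (Eventually.of_forall fun x => ?_)
    simp only [unitaryFourier, hψ, integral_planeWave_translate]
    rw [neg_div, Real.rpow_neg (by positivity), Complex.ofReal_inv]
    have := Complex.ofReal_ne_zero.2 hpos.ne'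
    field_simp
  rw [h2, enorm_mul, enorm_ofReal_of_nonneg hpos.le]
  gcongr
  refine (enorm_integral_le_lintegral_enorm _).trans ?_
  rw [ballMollify, ← lintegral_const_mul', ← lintegral_indicator measurableSet_ball]
  · refine lintegral_mono fun ξ => ?_
    rw [enorm_mul, hψ, enorm_ofReal_of_nonneg (hβ.nonneg _)]
    by_cases hξ : 2 * δ ≤ ‖ξ - z‖
    · rw [hβ.eq_zero_of_le_norm hξ]; simp
    · have : ξ ∈ ball w (4 * δ) := by
        rw [mem_ball]
        have := dist_triangle ξ z w
        rw [dist_eq_norm ξ z] at this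
        linarith
      rw [Set.indicator_of_mem this, mul_comm]
      gcongr
      exact hβ.le_inv_volume _
  · have hδ : 0 < δ := by linarith [dist_nonneg (x := z) (y := w)]
    exact ENNReal.inv_ne_top.2 (measure_closedBall_pos _ _ hδ).ne'

/-! ### Densities on the sphere and the Schur test -/

lemma lintegral_enorm_eq_of_nonneg {X : Type*} [MeasurableSpace X] {μ : Measure X} {g : X → ℂ}
    (hg : Integrable g μ) (h : ∀ᵐ x ∂μ, g x = (‖g x‖ : ℂ)) : ∫⁻ x, ‖g x‖ₑ ∂μ = ‖∫ x, g x ∂μ‖ₑ := by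
  rw [integral_congr_ae h, integral_complex_ofReal,
    enorm_ofReal_of_nonneg (integral_nonneg fun x => norm_nonneg _),
    ofReal_integral_norm_eq_lintegral_enorm hg]

lemma enorm_add_sq_le {E : Type*} [SeminormedAddCommGroup E] (u v : E) :
    ‖u + v‖ₑ ^ 2 ≤ 2 * (‖u‖ₑ ^ 2 + ‖v‖ₑ ^ 2) := by
  have h : ‖u + v‖₊ ^ 2 ≤ 2 * (‖u‖₊ ^ 2 + ‖v‖₊ ^ 2) :=
    (pow_le_pow_left₀ zero_le (nnnorm_add_le u v) 2).trans add_sq_le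
  simp only [enorm_eq_nnnorm]
  exact_mod_cast h

/-- The Fourier transform of a density on the sphere. -/
noncomputable def sphereWave {d : ℕ} (f : USphere d → ℂ) (x : RSpace d) : ℂ :=
  ∫ ξ : USphere d, f ξ * planeWave x ξ ∂(sphereMeasure d)

lemma conj_sphereWave {d : ℕ} (f : USphere d → ℂ) (x : RSpace d) :
    conj (sphereWave f x) =
      ∫ ξ : USphere d, conj (f ξ) * planeWave (-x) ξ ∂(sphereMeasure d) := by
  rw [sphereWave, ← integral_conj]
  simp only [map_mul, conj_planeWave]

/-- The Schur test for symmetric kernels. -/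
lemma lintegral_lintegral_mul_mul_le {X : Type*} [MeasurableSpace X] {μ : Measure X} [SFinite μ]
    {g : X → ENNReal} (hg : Measurable g) {k : X × X → ENNReal} (hk : Measurable k)
    (hsymm : ∀ x y, k (x, y) = k (y, x)) {B : ENNReal} (hB : ∀ x, ∫⁻ y, k (x, y) ∂μ ≤ B) :
    ∫⁻ x, ∫⁻ y, g x * (g y * k (x, y)) ∂μ ∂μ ≤ 2 * B * ∫⁻ x, g x ^ 2 ∂μ := by
  have m1 : Measurable fun p : X × X => g p.1 ^ 2 * k p := by fun_prop
  have m2 : Measurable fun p : X × X => g p.2 ^ 2 * k p := by fun_prop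
  have hdiag : ∫⁻ x, ∫⁻ y, g x ^ 2 * k (x, y) ∂μ ∂μ ≤ B * ∫⁻ x, g x ^ 2 ∂μ := by
    rw [← lintegral_const_mul _ (by fun_prop)]
    refine lintegral_mono fun x => ?_
    rw [lintegral_const_mul _ (by fun_prop), mul_comm]
    gcongr
    exact hB x
  have hswap : ∫⁻ x, ∫⁻ y, g y ^ 2 * k (x, y) ∂μ ∂μ = ∫⁻ x, ∫⁻ y, g x ^ 2 * k (x, y) ∂μ ∂μ := by
    rw [lintegral_lintegral_swap (f := fun x y => g y ^ 2 * k (x, y)) m2.aemeasurable]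
    exact lintegral_congr fun x => lintegral_congr fun y => by rw [hsymm]
  -- The crude `g x * g y ≤ g x ^ 2 + g y ^ 2` suffices; symmetry of the kernel makes the two terms
  -- equal.
  calc _ ≤ ∫⁻ x, ∫⁻ y, (g x ^ 2 * k (x, y) + g y ^ 2 * k (x, y)) ∂μ ∂μ := by
        refine lintegral_mono fun x => lintegral_mono fun y => ?_
        rw [← add_mul, ← mul_assoc]
        gcongr
        rcases le_total (g x) (g y) with h | h
        · refine le_trans ?_ le_add_self
          rw [sq]; gcongr
        · refine le_trans ?_ le_self_add
          rw [sq]; gcongr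
    _ = ∫⁻ x, ∫⁻ y, g x ^ 2 * k (x, y) ∂μ ∂μ + ∫⁻ x, ∫⁻ y, g y ^ 2 * k (x, y) ∂μ ∂μ := by
        rw [← lintegral_add_left m1.lintegral_prod_right']
        exact lintegral_congr fun x => lintegral_add_left (m1.comp measurable_prodMk_left) _
    _ ≤ _ := by
        rw [hswap, ← two_mul, mul_assoc]
        gcongr

/-- The Schur test on caps of the sphere. -/
lemma lintegral_cap_mul_mul_le {d : ℕ} {f : USphere d → ℂ} (hf : Measurable f)
    (hcap : ∀ ξ η, f ξ ≠ 0 → f η ≠ 0 → dist ξ η < 1 / 2)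
    {M : RSpace d → ENNReal} (hM : Measurable M) (hMeven : ∀ z, M (-z) = M z) {B : ENNReal}
    (hB : ∀ ξ : USphere d, ∫⁻ η in ball ξ (1 / 2), M ((ξ : RSpace d) - (η : RSpace d))
      ∂(sphereMeasure d) ≤ B) :
    ∫⁻ ξ, ∫⁻ η, ‖f ξ‖ₑ * (‖f η‖ₑ * M ((ξ : RSpace d) - (η : RSpace d)))
      ∂(sphereMeasure d) ∂(sphereMeasure d) ≤ 2 * B * ∫⁻ ξ, ‖f ξ‖ₑ ^ 2 ∂(sphereMeasure d) := by
  have hM' : Measurable fun p : USphere d × USphere d => M ((p.1 : RSpace d) - (p.2 : RSpace d)) :=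
    hM.comp (by fun_prop)
  have hset : MeasurableSet {p : USphere d × USphere d | dist p.2 p.1 < 1 / 2} :=
    measurableSet_lt (continuous_snd.dist continuous_fst).measurable measurable_const
  refine le_trans ?_ (lintegral_lintegral_mul_mul_le hf.enorm (hM'.indicator hset) ?_ (B := B) ?_)
  · refine lintegral_mono fun ξ => lintegral_mono fun η => ?_
    by_cases h1 : f ξ = 0
    · simp [h1]
    by_cases h2 : f η = 0
    · simp [h2]
    rw [Set.indicator_of_mem (show (ξ, η) ∈ {p : USphere d × USphere d | dist p.2 p.1 < 1 / 2} from
      hcap η ξ h2 h1)]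
  · intro ξ η
    simp only [Set.indicator, Set.mem_ofPred_eq, dist_comm ξ η]
    rw [← hMeven, neg_sub]
  · intro ξ
    refine le_trans (le_of_eq ?_) (hB ξ)
    rw [← lintegral_indicator measurableSet_ball]
    rfl

instance sFinite_sphereMeasure_prod_volume (d : ℕ) :
    SFinite ((sphereMeasure d).prod (volume : Measure (RSpace d))) :=
  Measure.prod.instSFinite

instance sFinite_sphereMeasure_prod_prod_volume (d : ℕ) :
    SFinite ((sphereMeasure d).prod ((sphereMeasure d).prod (volume : Measure (RSpace d)))) :=
  Measure.prod.instSFinite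

/-! ### The weighted `L²` bound -/

/-- One factor `β̂` stays with the gauge and makes it integrable. The conjugate factor is expanded,
with both sphere transforms, as an integral over `(ξ, η, t)`, and everything converges absolutely,
so Fubini applies. The inner integral is a Fourier transform of the regularized gauge at `η - ξ -
t`. -/
lemma integral_gauge_mul_sphereWave {d : ℕ} {φ : ℝ → ℝ} (hφ : IsAdmissibleRadialGauge d φ)
    {δ : ℝ} {β : RSpace d → ℝ} (hβ : IsMollifier δ β) {f : USphere d → ℂ}
    (hf : Integrable f (sphereMeasure d)) :
    let ν := (sphereMeasure d).prod ((sphereMeasure d).prod (volume : Measure (RSpace d)))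
    let q : USphere d × USphere d × RSpace d → ℂ :=
      fun p => f p.1 * (conj (f p.2.1) * (β p.2.2 : ℂ))
    let g : RSpace d → ℂ := fun x => (φ ‖x‖ : ℂ) * waveTransform β x *
      (sphereWave f x * (conj (sphereWave f x) * conj (waveTransform β x)))
    Integrable g ∧ ∫ x, g x = ∫ p : USphere d × USphere d × RSpace d,
      (q p * ∫ x : RSpace d, (φ ‖x‖ : ℂ) * waveTransform β x *
        planeWave (-x) ((p.2.1 : RSpace d) - p.1 - p.2.2)) ∂ν := by
  intro ν q g
  have : SFinite ν := sFinite_sphereMeasure_prod_prod_volume d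
  have hfc : Integrable (fun ξ => conj (f ξ)) (sphereMeasure d) := by
    simpa using (Complex.conjCLE.toContinuousLinearMap).integrable_comp hf
  have hq : Integrable q ν := hf.mul_prod (hfc.mul_prod hβ.integrable_ofReal)
  have hk := hφ.integrable_mul_waveTransform hβ
  have hkq := (hk.mul_prod hq).mul_bdd (c := 1)
    (g := fun z : RSpace d × (USphere d × USphere d × RSpace d) =>
      planeWave (-z.1) ((z.2.2.1 : RSpace d) - z.2.1 - z.2.2.2))
    (by fun_prop : Measurable _).aestronglyMeasurable
    (Eventually.of_forall fun z => (norm_planeWave _ _).le)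
  have hinner : ∀ x, ∫ p, (φ ‖x‖ : ℂ) * waveTransform β x * q p *
      planeWave (-x) ((p.2.1 : RSpace d) - p.1 - p.2.2) ∂ν = g x := fun x => by
    have e : ∀ p : USphere d × USphere d × RSpace d, (φ ‖x‖ : ℂ) * waveTransform β x * q p *
        planeWave (-x) ((p.2.1 : RSpace d) - p.1 - p.2.2) = (φ ‖x‖ : ℂ) * waveTransform β x *
        ((f p.1 * planeWave x p.1) * ((conj (f p.2.1) * planeWave (-x) p.2.1) *
          ((β p.2.2 : ℂ) * planeWave x p.2.2))) := fun p => by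
      rw [sub_eq_add_neg, sub_eq_add_neg, planeWave_add_right, planeWave_add_right,
        ← planeWave_neg_left, ← planeWave_neg_left, neg_neg]
      simp only [q]
      ring
    simp_rw [e]
    rw [integral_const_mul, integral_prod_mul (fun ξ : USphere d => f ξ * planeWave x ξ)
      (fun p : USphere d × RSpace d => (conj (f p.1) * planeWave (-x) p.1) *
          ((β p.2 : ℂ) * planeWave x p.2)),
      integral_prod_mul (fun ξ : USphere d => conj (f ξ) * planeWave (-x) ξ)
        (fun t : RSpace d => (β t : ℂ) * planeWave x t), ← conj_sphereWave, ← conj_waveTransform]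
    rfl
  constructor
  · exact hkq.integral_prod_left.congr (Eventually.of_forall hinner)
  · rw [← integral_congr_ae (Eventually.of_forall hinner),
      integral_integral_swap (f := fun x p => (φ ‖x‖ : ℂ) * waveTransform β x * q p *
        planeWave (-x) ((p.2.1 : RSpace d) - p.1 - p.2.2)) hkq]
    refine integral_congr_ae (Eventually.of_forall fun p => ?_)
    simp only
    rw [← integral_const_mul]
    refine integral_congr_ae (Eventually.of_forall fun x => ?_)
    simp only
    ring

lemma IsAdmissibleRadialGauge.ae_nonneg {d : ℕ} (hd : 1 ≤ d) {φ : ℝ → ℝ}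
    (hφ : IsAdmissibleRadialGauge d φ) : ∀ᵐ x : RSpace d, 0 ≤ φ ‖x‖ := by
  have : Nontrivial (RSpace d) := by
    have : Nonempty (Fin d) := ⟨⟨0, hd⟩⟩
    infer_instance
  have h0 : ∀ᵐ x : RSpace d, x ≠ 0 := by simp [ae_iff, measure_singleton]
  exact h0.mono fun x hx => (hφ.pos _ (norm_pos_iff.2 hx)).le

/-- The constant does not depend on `δ` or `β`; this is what permits removing the mollifier. -/
lemma exists_lintegral_gauge_mollified_le {n : ℕ} (hn : 1 ≤ n) {φ : ℝ → ℝ}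
    (hφ : IsAdmissibleRadialGauge (n + 1) φ) : ∃ C : NNReal, ∀ δ ∈ Set.Ioc (0 : ℝ) (1 / 8),
    ∀ β : RSpace (n + 1) → ℝ, IsMollifier δ β →
    ∀ f : USphere (n + 1) → ℂ, Measurable f → Integrable f (sphereMeasure (n + 1)) →
    (∀ ξ η, f ξ ≠ 0 → f η ≠ 0 → dist ξ η < 1 / 2) →
    ∫⁻ x : RSpace (n + 1), ‖φ ‖x‖‖ₑ * ‖waveTransform β x‖ₑ ^ 2 * ‖sphereWave f x‖ₑ ^ 2 ≤
      C * ∫⁻ ξ, ‖f ξ‖ₑ ^ 2 ∂(sphereMeasure (n + 1)) := by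
  obtain ⟨F, hFm, hF, hFint⟩ := hφ.fourier
  obtain ⟨C, hC⟩ := exists_lintegral_cap_ballMollify_le n hn
  have hJ := lintegral_Ioo_lt_top_of_integrableOn hn hFm hFint
  set J := ∫⁻ r in Set.Ioo (0 : ℝ) 2, ENNReal.ofReal (r ^ (n - 1)) * ‖F r‖ₑ with hJdef
  set K := ENNReal.ofReal ((2 * Real.pi) ^ (((n + 1 : ℕ) : ℝ) / 2)) with hK
  refine ⟨(K * (2 * (C * J))).toNNReal, fun δ hδ β hβ f hfm hf hcap => ?_⟩
  have hfin : K * (2 * (C * J)) ≠ ⊤ := by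
    refine ENNReal.mul_ne_top ENNReal.ofReal_ne_top (ENNReal.mul_ne_top (by simp) ?_)
    exact ENNReal.mul_ne_top ENNReal.coe_ne_top hJ.ne
  rw [ENNReal.coe_toNNReal hfin]
  obtain ⟨hg, hgint⟩ := integral_gauge_mul_sphereWave hφ hβ hf
  set M : RSpace (n + 1) → ENNReal := ballMollify (fun r => ‖F r‖ₑ) δ with hM
  have hMm : Measurable M := measurable_ballMollify hFm.enorm δ
  have hMeven : ∀ z, M (-z) = M z := fun z => ballMollify_eq_of_norm_eq _ _ (norm_neg z)
  have hMc : Measurable fun p : USphere (n + 1) × USphere (n + 1) =>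
      M ((p.1 : RSpace (n + 1)) - (p.2 : RSpace (n + 1))) := hMm.comp (by fun_prop)
  calc ∫⁻ x : RSpace (n + 1), ‖φ ‖x‖‖ₑ * ‖waveTransform β x‖ₑ ^ 2 * ‖sphereWave f x‖ₑ ^ 2
      = ∫⁻ x : RSpace (n + 1), ‖(φ ‖x‖ : ℂ) * waveTransform β x *
      (sphereWave f x * (conj (sphereWave f x) * conj (waveTransform β x)))‖ₑ := by
        refine lintegral_congr fun x => ?_
        simp only [enorm_mul, RCLike.enorm_conj]
        rw [show ‖(φ ‖x‖ : ℂ)‖ₑ = ‖φ ‖x‖‖ₑ by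
          rw [← ofReal_norm, Complex.norm_real, ofReal_norm]]
        ring
    _ = ‖∫ x : RSpace (n + 1), (φ ‖x‖ : ℂ) * waveTransform β x *
      (sphereWave f x * (conj (sphereWave f x) * conj (waveTransform β x)))‖ₑ := by
        -- Positivity of the gauge enters here: the integrand is `φ |β̂|² |f̂|² ≥ 0`, so the
        -- integral of its absolute value can be computed by Fubini without losing cancellation.
        refine lintegral_enorm_eq_of_nonneg hg ((hφ.ae_nonneg (by omega)).mono fun x hx => ?_)
        simp only [norm_mul, RCLike.norm_conj, Complex.norm_real, Real.norm_of_nonneg hx]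
        push_cast
        rw [show (φ ‖x‖ : ℂ) * waveTransform β x *
          (sphereWave f x * (conj (sphereWave f x) * conj (waveTransform β x))) = (φ ‖x‖ : ℂ) *
          (waveTransform β x * conj (waveTransform β x)) *
          (sphereWave f x * conj (sphereWave f x)) by ring, Complex.mul_conj', Complex.mul_conj']
        ring
    _ ≤ ∫⁻ p : USphere (n + 1) × USphere (n + 1) × RSpace (n + 1),
          ‖f p.1‖ₑ * (‖f p.2.1‖ₑ * ENNReal.ofReal (β p.2.2)) *
            (K * M ((p.1 : RSpace (n + 1)) - p.2.1))
          ∂((sphereMeasure (n + 1)).prod ((sphereMeasure (n + 1)).prod volume)) := by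
        rw [hgint]
        refine (enorm_integral_le_lintegral_enorm _).trans (lintegral_mono fun p => ?_)
        obtain ⟨ξ, η, t⟩ := p
        simp only [enorm_mul, RCLike.enorm_conj, enorm_ofReal_of_nonneg (hβ.nonneg t)]
        by_cases h1 : f ξ = 0
        · simp [h1]
        by_cases h2 : f η = 0
        · simp [h2]
        by_cases h3 : 2 * δ ≤ ‖t‖
        · simp [hβ.eq_zero_of_le_norm h3]
        gcongr
        rw [not_le] at h3
        have hd : ‖(η : RSpace (n + 1)) - ξ‖ < 1 / 2 := by
          rw [← dist_eq_norm]; exact hcap η ξ h2 h1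
        rw [← hMeven, neg_sub]
        -- With `z = η - ξ - t` one has `‖z‖ + 2 * δ < 1/2 + 4 * δ ≤ 1`, inside the region where the
        -- Fourier transform of the gauge is `F`. Moreover `z` is within `2 * δ` of `η - ξ`, so the
        -- resulting bound no longer depends on `t`.
        refine enorm_integral_gauge_waveTransform_le hF hβ ?_ ?_
        · have := norm_sub_le ((η : RSpace (n + 1)) - ξ) t
          linarith [hδ.2]
        · rw [dist_eq_norm, sub_sub_cancel_left, norm_neg]
          exact h3
    _ = K * ∫⁻ ξ, ∫⁻ η, ‖f ξ‖ₑ * (‖f η‖ₑ * M ((ξ : RSpace (n + 1)) - (η : RSpace (n + 1))))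
          ∂(sphereMeasure (n + 1)) ∂(sphereMeasure (n + 1)) := by
        have hβm : Measurable β := hβ.contDiff.continuous.measurable
        rw [lintegral_prod _ (by fun_prop), ← lintegral_const_mul _
          (Measurable.lintegral_prod_right' (f := fun p : USphere (n + 1) × USphere (n + 1) =>
            ‖f p.1‖ₑ * (‖f p.2‖ₑ * M ((p.1 : RSpace (n + 1)) - (p.2 : RSpace (n + 1)))))
            (by fun_prop))]
        refine lintegral_congr fun ξ => ?_
        have hMξ : Measurable fun η : USphere (n + 1) =>
          M ((ξ : RSpace (n + 1)) - (η : RSpace (n + 1))) := hMm.comp (by fun_prop)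
        rw [lintegral_prod _ (by fun_prop), ← lintegral_const_mul _ (by fun_prop)]
        refine lintegral_congr fun η => ?_
        simp only
        calc _ = ∫⁻ t, ENNReal.ofReal (β t) * (‖f ξ‖ₑ * ‖f η‖ₑ *
              (K * M ((ξ : RSpace (n + 1)) - (η : RSpace (n + 1))))) :=
              lintegral_congr fun t => by ring
          _ = _ := by
              rw [lintegral_mul_const _ (by fun_prop), hβ.lintegral_eq_one]
              ring
    _ ≤ _ := by
        rw [mul_assoc]
        gcongr
        exact lintegral_cap_mul_mul_le hfm hcap hMm hMeven fun ξ => hC _ hFm.enorm δ hδ ξ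

lemma exists_lintegral_gauge_cap_le {n : ℕ} (hn : 1 ≤ n) {φ : ℝ → ℝ}
    (hφ : IsAdmissibleRadialGauge (n + 1) φ) : ∃ C : NNReal,
    ∀ f : USphere (n + 1) → ℂ, Measurable f → Integrable f (sphereMeasure (n + 1)) →
    (∀ ξ η, f ξ ≠ 0 → f η ≠ 0 → dist ξ η < 1 / 2) →
    ∫⁻ x : RSpace (n + 1), ‖φ ‖x‖‖ₑ * ‖sphereWave f x‖ₑ ^ 2 ≤
      C * ∫⁻ ξ, ‖f ξ‖ₑ ^ 2 ∂(sphereMeasure (n + 1)) := by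
  obtain ⟨C, hC⟩ := exists_lintegral_gauge_mollified_le hn hφ
  refine ⟨4 * C, fun f hfm hf hcap => ?_⟩
  set h : RSpace (n + 1) → ENNReal := fun x => ‖φ ‖x‖‖ₑ * ‖sphereWave f x‖ₑ ^ 2 with hh
  have hball : ∀ m : ℕ, ∫⁻ x in closedBall 0 (2 * (m + 1 : ℝ)), h x ≤
      (4 * C : NNReal) * ∫⁻ ξ, ‖f ξ‖ₑ ^ 2 ∂(sphereMeasure (n + 1)) := fun m => by
    have hm : (0 : ℝ) < m + 1 := by positivity
    -- Chosen so that `‖x‖ * (2 * δ) ≤ 1/2` on the ball of radius `2 (m + 1)`. There `|β̂| ≥ 1/2`,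
    -- which costs the factor 4.
    set δ : ℝ := 1 / (8 * (m + 1)) with hδ
    have hδ0 : 0 < δ := by positivity
    have hδ1 : δ ≤ 1 / 8 := by
      rw [hδ, div_le_div_iff₀ (by positivity) (by norm_num)]
      nlinarith [Nat.cast_nonneg (α := ℝ) m]
    obtain ⟨β, hβ⟩ := exists_isMollifier (n + 1) hδ0
    push_cast
    rw [mul_assoc]
    refine le_trans ?_ (mul_le_mul_right (hC δ ⟨hδ0, hδ1⟩ β hβ f hfm hf hcap) 4)
    rw [← lintegral_const_mul' _ _ (by simp), ← lintegral_indicator measurableSet_closedBall]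
    refine lintegral_mono fun x => ?_
    by_cases hx : x ∈ closedBall (0 : RSpace (n + 1)) (2 * (m + 1 : ℝ))
    swap
    · rw [Set.indicator_of_notMem hx]
      exact zero_le
    rw [Set.indicator_of_mem hx]
    have hx' : ‖x‖ * (2 * δ) ≤ 1 / 2 := by
      rw [mem_closedBall_zero_iff] at hx
      calc ‖x‖ * (2 * δ) ≤ 2 * (m + 1 : ℝ) * (2 * δ) := by gcongr
        _ = 1 / 2 := by rw [hδ]; field_simp; norm_num
    have h1 : (1 : ENNReal) ≤ 4 * ‖waveTransform β x‖ₑ ^ 2 := by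
      have h2 := hβ.half_le_norm_waveTransform hx'
      rw [← ofReal_norm, ← ENNReal.ofReal_pow (norm_nonneg _),
        show (4 : ENNReal) = ENNReal.ofReal 4 by norm_num, ← ENNReal.ofReal_mul (by norm_num),
        ENNReal.one_le_ofReal]
      nlinarith
    calc h x = 1 * (‖φ ‖x‖‖ₑ * ‖sphereWave f x‖ₑ ^ 2) := by rw [one_mul]
      _ ≤ 4 * ‖waveTransform β x‖ₑ ^ 2 * (‖φ ‖x‖‖ₑ * ‖sphereWave f x‖ₑ ^ 2) := by gcongr
      _ = _ := by ring
  have hmono : Monotone fun m : ℕ => closedBall (0 : RSpace (n + 1)) (2 * (m + 1 : ℝ)) :=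
    fun a b hab => closedBall_subset_closedBall (by
      have : (a : ℝ) ≤ b := Nat.cast_le.2 hab
      linarith)
  have huniv : ⋃ m : ℕ, closedBall (0 : RSpace (n + 1)) (2 * (m + 1 : ℝ)) = Set.univ := by
    refine Set.eq_univ_of_forall fun x => Set.mem_iUnion.2 ?_
    obtain ⟨m, hm⟩ := exists_nat_ge ‖x‖
    exact ⟨m, by rw [mem_closedBall_zero_iff]; linarith [norm_nonneg x]⟩
  rw [← setLIntegral_univ, ← huniv, setLIntegral_iUnion_of_directed _ hmono.directed_le]
  exact iSup_le hball

lemma sphereWave_add {d : ℕ} {f g : USphere d → ℂ} (hf : Integrable f (sphereMeasure d))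
    (hg : Integrable g (sphereMeasure d)) (x : RSpace d) :
    sphereWave (f + g) x = sphereWave f x + sphereWave g x := by
  simp only [sphereWave, Pi.add_apply, add_mul]
  exact integral_add (integrable_mul_planeWave hf x) (integrable_mul_planeWave hg x)

lemma continuous_sphereWave {d : ℕ} {f : USphere d → ℂ} (hf : Integrable f (sphereMeasure d)) :
    Continuous (sphereWave f) := by
  refine continuous_of_dominated (bound := fun ξ => ‖f ξ‖) (fun x => ?_) (fun x => ?_) hf.norm ?_
  · exact (integrable_mul_planeWave hf x).1
  · exact Eventually.of_forall fun ξ => by simp [norm_planeWave]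
  · exact Eventually.of_forall fun ξ => by fun_prop

/-- The weighted `L²` bound for Fourier transforms of densities on the sphere. -/
lemma exists_lintegral_gauge_sphereWave_le {n : ℕ} (hn : 1 ≤ n) {φ : ℝ → ℝ}
    (hφ : IsAdmissibleRadialGauge (n + 1) φ) : ∃ C : NNReal,
    ∀ f : USphere (n + 1) → ℂ, Measurable f → Integrable f (sphereMeasure (n + 1)) →
    ∫⁻ x : RSpace (n + 1), ‖φ ‖x‖‖ₑ * ‖sphereWave f x‖ₑ ^ 2 ≤
      C * ∫⁻ ξ, ‖f ξ‖ₑ ^ 2 ∂(sphereMeasure (n + 1)) := by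
  obtain ⟨C₀, hC₀⟩ := exists_lintegral_gauge_cap_le hn hφ
  have hφm : AEMeasurable (fun x : RSpace (n + 1) => ‖φ ‖x‖‖ₑ) :=
    hφ.locallyIntegrable.aestronglyMeasurable.enorm
  -- Compactness induction requires a property inherited by arbitrary subsets, while cutting a
  -- density requires measurability; hence the measurable superset `A'`.
  let P : Set (USphere (n + 1)) → Prop := fun A => ∃ A', A ⊆ A' ∧ MeasurableSet A' ∧ ∃ C : NNReal,
    ∀ f : USphere (n + 1) → ℂ, Measurable f → Integrable f (sphereMeasure (n + 1)) →
    (∀ ξ ∉ A', f ξ = 0) →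
    ∫⁻ x : RSpace (n + 1), ‖φ ‖x‖‖ₑ * ‖sphereWave f x‖ₑ ^ 2 ≤
      C * ∫⁻ ξ, ‖f ξ‖ₑ ^ 2 ∂(sphereMeasure (n + 1))
  have hP : P Set.univ := by
    refine isCompact_univ.induction_on (p := P) ?_ ?_ ?_ ?_
    · refine ⟨∅, le_rfl, MeasurableSet.empty, 0, fun f _ _ h0 => ?_⟩
      have : f = 0 := funext fun ξ => h0 ξ (Set.notMem_empty ξ)
      simp [this, sphereWave]
    · rintro A B hAB ⟨B', h1, h2⟩
      exact ⟨B', hAB.trans h1, h2⟩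
    · rintro A B ⟨A', hA, hAm, C₁, h₁⟩ ⟨B', hB, hBm, C₂, h₂⟩
      refine ⟨A' ∪ B', Set.union_subset_union hA hB, hAm.union hBm, 2 * (C₁ + C₂),
        fun f hfm hf h0 => ?_⟩
      set f₁ := A'.indicator f with hf₁
      set f₂ := A'ᶜ.indicator f with hf₂
      have hsum : f = f₁ + f₂ := (Set.indicator_self_add_compl A' f).symm
      have hi₁ : Integrable f₁ (sphereMeasure (n + 1)) := hf.indicator hAm
      have hi₂ : Integrable f₂ (sphereMeasure (n + 1)) := hf.indicator hAm.compl
      have b₁ := h₁ f₁ (hfm.indicator hAm) hi₁ fun ξ hξ => Set.indicator_of_notMem hξ f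
      have b₂ := h₂ f₂ (hfm.indicator hAm.compl) hi₂ fun ξ hξ => by
        by_cases hA' : ξ ∈ A'
        · exact Set.indicator_of_notMem (Set.notMem_compl_iff.2 hA') f
        · rw [hf₂, Set.indicator_of_mem hA']
          exact h0 ξ fun h => h.elim hA' hξ
      have le_of : ∀ S : Set (USphere (n + 1)), ∫⁻ ξ, ‖S.indicator f ξ‖ₑ ^ 2
          ∂(sphereMeasure (n + 1)) ≤ ∫⁻ ξ, ‖f ξ‖ₑ ^ 2 ∂(sphereMeasure (n + 1)) := fun S => by
        refine lintegral_mono fun ξ => ?_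
        gcongr
        rw [enorm_indicator_eq_indicator_enorm]
        exact Set.indicator_le_self _ _ _
      calc _ ≤ ∫⁻ x : RSpace (n + 1), 2 * (‖φ ‖x‖‖ₑ * ‖sphereWave f₁ x‖ₑ ^ 2 +
            ‖φ ‖x‖‖ₑ * ‖sphereWave f₂ x‖ₑ ^ 2) := by
            refine lintegral_mono fun x => ?_
            rw [hsum, sphereWave_add hi₁ hi₂]
            calc _ ≤ ‖φ ‖x‖‖ₑ * (2 * (‖sphereWave f₁ x‖ₑ ^ 2 + ‖sphereWave f₂ x‖ₑ ^ 2)) := by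
                  gcongr
                  exact enorm_add_sq_le _ _
              _ = _ := by ring
        _ = 2 * ((∫⁻ x : RSpace (n + 1), ‖φ ‖x‖‖ₑ * ‖sphereWave f₁ x‖ₑ ^ 2) +
            ∫⁻ x : RSpace (n + 1), ‖φ ‖x‖‖ₑ * ‖sphereWave f₂ x‖ₑ ^ 2) := by
            have := (continuous_sphereWave hi₁).measurable
            rw [lintegral_const_mul' _ _ (by simp), lintegral_add_left' (by fun_prop)]
        _ ≤ 2 * (C₁ * ∫⁻ ξ, ‖f ξ‖ₑ ^ 2 ∂(sphereMeasure (n + 1)) +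
            C₂ * ∫⁻ ξ, ‖f ξ‖ₑ ^ 2 ∂(sphereMeasure (n + 1))) := by
            gcongr
            · exact b₁.trans (mul_le_mul_right (le_of _) _)
            · exact b₂.trans (mul_le_mul_right (le_of _) _)
        _ = _ := by push_cast; ring
    · intro ξ _
      refine ⟨ball ξ (1 / 4), mem_nhdsWithin_of_mem_nhds (ball_mem_nhds ξ (by norm_num)),
        ball ξ (1 / 4), le_rfl, measurableSet_ball, C₀, fun f hfm hf h0 => hC₀ f hfm hf ?_⟩
      intro η ζ hη hζ
      have h1 : dist η ξ < 1 / 4 := by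
        by_contra h; exact hη (h0 η h)
      have h2 : dist ζ ξ < 1 / 4 := by
        by_contra h; exact hζ (h0 ζ h)
      linarith [dist_triangle_right η ζ ξ]
  obtain ⟨A, hA, -, C, hC⟩ := hP
  exact ⟨C, fun f hfm hf => hC f hfm hf fun ξ hξ => (hξ (hA (Set.mem_univ ξ))).elim⟩

/-- The weighted `L²` bound for Herglotz solutions. -/
lemma IsAdmissibleRadialGauge.exists_lintegral_le {d : ℕ} (hd : 2 ≤ d) {φ : ℝ → ℝ}
    (hφ : IsAdmissibleRadialGauge d φ) : ∃ C : NNReal, ∀ u : HerglotzSpace d,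
    ∫⁻ x : RSpace d, ‖φ ‖x‖‖ₑ * ‖u x‖ₑ ^ 2 ≤ C * ‖u‖ₑ ^ 2 := by
  obtain ⟨n, rfl⟩ : ∃ n, d = n + 1 := ⟨d - 1, by omega⟩
  obtain ⟨C, hC⟩ := exists_lintegral_gauge_sphereWave_le (by omega) hφ
  refine ⟨‖(herglotzConst (n + 1) : ℂ)‖₊ ^ 2 * C, fun u => ?_⟩
  obtain ⟨f, rfl⟩ := (HerglotzSpace.I (n + 1)).surjective u
  have hnorm : ‖HerglotzSpace.I (n + 1) f‖ₑ = ‖f‖ₑ := by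
    rw [← ofReal_norm, ← ofReal_norm, (HerglotzSpace.isometry_I (n + 1)).norm_map_of_map_zero
      (map_zero _)]
  have hval : ∀ x, (HerglotzSpace.I (n + 1) f) x = (herglotzConst (n + 1) : ℂ) * sphereWave f x :=
    fun x => rfl
  have hL2 : ∫⁻ ξ, ‖f ξ‖ₑ ^ 2 ∂(sphereMeasure (n + 1)) = ‖f‖ₑ ^ 2 := by
    rw [Lp.enorm_def, eLpNorm_eq_lintegral_rpow_enorm_toReal (by norm_num) (by norm_num)]
    simp only [ENNReal.toReal_ofNat]
    rw [← ENNReal.rpow_natCast, ← ENNReal.rpow_mul]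
    norm_num
  rw [hnorm, ← hL2]
  simp only [hval, enorm_mul, mul_pow]
  calc _ = ‖(herglotzConst (n + 1) : ℂ)‖ₑ ^ 2 *
        ∫⁻ x : RSpace (n + 1), ‖φ ‖x‖‖ₑ * ‖sphereWave f x‖ₑ ^ 2 := by
        rw [← lintegral_const_mul' _ _ (by simp)]
        exact lintegral_congr fun x => by ring
    _ ≤ ‖(herglotzConst (n + 1) : ℂ)‖ₑ ^ 2 * (C * ∫⁻ ξ, ‖f ξ‖ₑ ^ 2 ∂(sphereMeasure (n + 1))) := by
        gcongr
        exact hC f (Lp.stronglyMeasurable f).measurable f.integrable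
    _ = _ := by push_cast; rw [enorm_eq_nnnorm]; ring

/-! ### The reproducing kernel -/

namespace HerglotzSpace

variable {d : ℕ}

lemma inner_kernel (x : RSpace d) (u : HerglotzSpace d) : inner ℂ (kernel x) u = u x := by
  obtain ⟨f, rfl⟩ := (I d).surjective u
  change inner ℂ ((I d).symm (I d (kernelDensity x))) ((I d).symm (I d f)) = herglotzMap d f x
  rw [LinearEquiv.symm_apply_apply, LinearEquiv.symm_apply_apply, L2.inner_def, herglotzMap_apply,
    ← integral_const_mul]
  refine integral_congr_ae ?_
  filter_upwards [MemLp.coeFn_toLp (MemLp.of_bound (μ := sphereMeasure d) (p := 2)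
    (f := fun ξ : USphere d => (herglotzConst d : ℂ) * planeWave (-x) ξ)
    (((continuous_planeWave (-x)).const_mul _).aestronglyMeasurable)
      (herglotzConst d)
      (Eventually.of_forall fun ξ => by
        rw [norm_mul, norm_planeWave, mul_one, Complex.norm_real,
          Real.norm_of_nonneg (herglotzConst_pos d).le]))] with ξ hξ
  change inner ℂ ((kernelDensity x : USphere d → ℂ) ξ) (f ξ) = _
  rw [kernelDensity, hξ, RCLike.inner_apply, map_mul, conj_planeWave, neg_neg, Complex.conj_ofReal]
  ring

lemma norm_I (f : SphereL2 d) : ‖I d f‖ = ‖f‖ :=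
  (isometry_I d).norm_map_of_map_zero (map_zero _) f

lemma norm_planeWave_sub_le (x y ξ : RSpace d) :
    ‖planeWave x ξ - planeWave y ξ‖ ≤ ‖x - y‖ * ‖ξ‖ := by
  have e : planeWave x ξ - planeWave y ξ = planeWave y ξ * (planeWave (x - y) ξ - 1) := by
    rw [mul_sub, ← planeWave_add_left, mul_one, add_sub_cancel]
  rw [e, norm_mul, norm_planeWave, one_mul]
  exact Real.norm_exp_I_mul_ofReal_sub_one_le.trans (norm_inner_le_norm _ _)

lemma coeFn_kernelDensity (x : RSpace d) : kernelDensity x =ᵐ[sphereMeasure d]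
    fun ξ : USphere d => (herglotzConst d : ℂ) * planeWave (-x) ξ :=
  MemLp.coeFn_toLp _

lemma exists_norm_kernel_le (d : ℕ) : ∃ C : NNReal, ∀ x : RSpace d, ‖kernel x‖ ≤ C := by
  refine ⟨(measureUnivNNReal (sphereMeasure d) ^ ((2 : ENNReal).toReal)⁻¹ *
    (herglotzConst d).toNNReal), fun x => ?_⟩
  rw [kernel, norm_I]
  push_cast
  rw [Real.coe_toNNReal _ (herglotzConst_pos d).le]
  refine Lp.norm_le_of_ae_bound (herglotzConst_pos d).le ?_
  filter_upwards [coeFn_kernelDensity x] with ξ hξ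
  rw [hξ, norm_mul, norm_planeWave, mul_one, Complex.norm_real,
    Real.norm_of_nonneg (herglotzConst_pos d).le]

lemma continuous_kernel : Continuous (kernel : RSpace d → HerglotzSpace d) := by
  set A : NNReal := measureUnivNNReal (sphereMeasure d) ^ ((2 : ENNReal).toReal)⁻¹ *
    (herglotzConst d).toNNReal with hA
  refine (LipschitzWith.of_dist_le_mul (K := A) fun x y => ?_).continuous
  rw [dist_eq_norm, kernel, kernel, ← map_sub, norm_I, dist_eq_norm, hA]
  push_cast
  rw [Real.coe_toNNReal _ (herglotzConst_pos d).le, mul_assoc]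
  have := herglotzConst_pos d
  refine Lp.norm_le_of_ae_bound (by positivity) ?_
  filter_upwards [coeFn_kernelDensity x, coeFn_kernelDensity y,
    Lp.coeFn_sub (kernelDensity x) (kernelDensity y)] with ξ hx hy hs
  rw [hs, Pi.sub_apply, hx, hy, ← mul_sub, norm_mul, Complex.norm_real, Real.norm_of_nonneg this.le]
  have h1 := norm_planeWave_sub_le (-x) (-y) ξ
  have h2 : ‖-x - -y‖ = ‖x - y‖ := by rw [← norm_neg]; congr 1; abel
  have h3 : ‖(ξ : RSpace d)‖ = 1 := by simp
  rw [h2, h3, mul_one] at h1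
  gcongr

lemma continuous_coe (u : HerglotzSpace d) : Continuous u := by
  have : (u : RSpace d → ℂ) = fun x => inner ℂ (kernel x) u := funext fun x => (inner_kernel x u).symm
  rw [this]
  exact continuous_kernel.inner continuous_const

lemma smul_coe (c : ℂ) (u : HerglotzSpace d) (x : RSpace d) : (c • u) x = c * u x := rfl

lemma add_coe (u v : HerglotzSpace d) (x : RSpace d) : (u + v) x = u x + v x := rfl

lemma exists_enorm_apply_le (d : ℕ) : ∃ C : NNReal, ∀ (u : HerglotzSpace d) (x : RSpace d),
    ‖u x‖ₑ ≤ C * ‖u‖ₑ := by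
  obtain ⟨C, hC⟩ := exists_norm_kernel_le d
  refine ⟨C, fun u x => ?_⟩
  have h : ‖u x‖₊ ≤ C * ‖u‖₊ := by
    rw [← NNReal.coe_le_coe]
    push_cast
    rw [← inner_kernel]
    exact (norm_inner_le_norm _ _).trans (by gcongr; exact hC x)
  simp only [enorm_eq_nnnorm]
  exact_mod_cast h

end HerglotzSpace

/-! ### From weighted bounds to bounded operators -/

open HerglotzSpace

/-- The bound `∫ |b| |u|² ≤ M ‖u‖²` on the whole Herglotz space. -/
def IsHerglotzCarleson {d : ℕ} (b : RSpace d → ℂ) (M : NNReal) : Prop :=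
  ∀ u : HerglotzSpace d, ∫⁻ x, ‖b x‖ₑ * ‖u x‖ₑ ^ 2 ≤ M * ‖u‖ₑ ^ 2

namespace IsHerglotzCarleson

variable {d : ℕ} {b : RSpace d → ℂ} {M : NNReal}

lemma lintegral_mul_mul_le (h : IsHerglotzCarleson b M) (hb : AEStronglyMeasurable b)
    (u v : HerglotzSpace d) :
    ∫⁻ x, ‖b x‖ₑ * (‖u x‖ₑ * ‖v x‖ₑ) ≤ 2 * M * (‖u‖ₑ * ‖v‖ₑ) := by
  -- For unit vectors `s * t ≤ s ^ 2 + t ^ 2` already gives the bound; homogeneity does the rest, at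
  -- the price of a factor 2.
  have unit : ∀ u v : HerglotzSpace d, ‖u‖ = 1 → ‖v‖ = 1 →
      ∫⁻ x, ‖b x‖ₑ * (‖u x‖ₑ * ‖v x‖ₑ) ≤ 2 * M := by
    intro u v hu hv
    have hu' : ‖u‖ₑ = 1 := by rw [← ofReal_norm, hu, ENNReal.ofReal_one]
    have hv' : ‖v‖ₑ = 1 := by rw [← ofReal_norm, hv, ENNReal.ofReal_one]
    have hum := (continuous_coe u).measurable
    have hbm := hb.enorm
    calc _ ≤ ∫⁻ x, (‖b x‖ₑ * ‖u x‖ₑ ^ 2 + ‖b x‖ₑ * ‖v x‖ₑ ^ 2) := by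
          refine lintegral_mono fun x => ?_
          rw [← mul_add]
          gcongr
          rcases le_total ‖u x‖ₑ ‖v x‖ₑ with h | h
          · refine le_trans ?_ le_add_self
            rw [sq]; gcongr
          · refine le_trans ?_ le_self_add
            rw [sq]; gcongr
      _ = (∫⁻ x, ‖b x‖ₑ * ‖u x‖ₑ ^ 2) + ∫⁻ x, ‖b x‖ₑ * ‖v x‖ₑ ^ 2 :=
          lintegral_add_left' (by fun_prop) _
      _ ≤ M * ‖u‖ₑ ^ 2 + M * ‖v‖ₑ ^ 2 := add_le_add (h u) (h v)
      _ = 2 * M := by rw [hu', hv']; ring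
  have zero_coe : ∀ x, (0 : HerglotzSpace d) x = 0 := fun x => rfl
  rcases eq_or_ne u 0 with rfl | hu
  · simp [zero_coe]
  rcases eq_or_ne v 0 with rfl | hv
  · simp [zero_coe]
  have scale : ∀ w : HerglotzSpace d, w ≠ 0 →
      ∃ w' : HerglotzSpace d, ‖w'‖ = 1 ∧ ∀ x, ‖w x‖ₑ = ‖w‖ₑ * ‖w' x‖ₑ := by
    intro w hw
    have hw' : ‖w‖ ≠ 0 := norm_ne_zero_iff.2 hw
    refine ⟨((‖w‖⁻¹ : ℝ) : ℂ) • w, ?_, fun x => ?_⟩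
    · rw [norm_smul, Complex.norm_real, norm_inv, norm_norm, inv_mul_cancel₀ hw']
    · rw [smul_coe, enorm_mul, enorm_ofReal_of_nonneg (by positivity), ← mul_assoc, ← ofReal_norm w,
        ← ENNReal.ofReal_mul (norm_nonneg _), mul_inv_cancel₀ hw', ENNReal.ofReal_one, one_mul]
  obtain ⟨u', hu', hux⟩ := scale u hu
  obtain ⟨v', hv', hvx⟩ := scale v hv
  calc _ = ‖u‖ₑ * ‖v‖ₑ * ∫⁻ x, ‖b x‖ₑ * (‖u' x‖ₑ * ‖v' x‖ₑ) := by
        rw [← lintegral_const_mul' _ _ (by finiteness)]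
        refine lintegral_congr fun x => ?_
        rw [hux, hvx]
        ring
    _ ≤ ‖u‖ₑ * ‖v‖ₑ * (2 * M) := by
        gcongr
        exact unit u' v' hu' hv'
    _ = _ := mul_comm _ _

lemma integrable (h : IsHerglotzCarleson b M) (hb : AEStronglyMeasurable b)
    (u v : HerglotzSpace d) : Integrable fun x => b x * u x * conj (v x) := by
  refine ⟨(hb.mul (continuous_coe u).aestronglyMeasurable).mul
    (Complex.continuous_conj.comp (continuous_coe v)).aestronglyMeasurable, ?_⟩
  refine lt_of_eq_of_lt ?_ ((h.lintegral_mul_mul_le hb u v).trans_lt (by finiteness))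
  refine lintegral_congr fun x => ?_
  rw [enorm_mul, enorm_mul, RCLike.enorm_conj, mul_assoc]

lemma norm_toeplitzForm_le (h : IsHerglotzCarleson b M) (hb : AEStronglyMeasurable b)
    (u v : HerglotzSpace d) : ‖toeplitzForm b u v‖ ≤ 2 * M * ‖u‖ * ‖v‖ := by
  have h1 : ‖toeplitzForm b u v‖ₑ ≤ 2 * M * (‖u‖ₑ * ‖v‖ₑ) := by
    refine (enorm_integral_le_lintegral_enorm _).trans (le_of_eq_of_le ?_
      (h.lintegral_mul_mul_le hb u v))
    refine lintegral_congr fun x => ?_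
    rw [enorm_mul, enorm_mul, RCLike.enorm_conj, mul_assoc]
  have h2 : ‖toeplitzForm b u v‖₊ ≤ 2 * M * (‖u‖₊ * ‖v‖₊) := by
    simp only [enorm_eq_nnnorm] at h1
    exact_mod_cast h1
  rw [mul_assoc]
  exact_mod_cast h2

lemma isBoundedToeplitzForm (h : IsHerglotzCarleson b M) (hb : AEStronglyMeasurable b) :
    IsBoundedToeplitzForm b :=
  ⟨h.integrable hb, 2 * M, h.norm_toeplitzForm_le hb⟩

/-- The operator represented by a bounded Toeplitz form. -/
lemma exists_operator (h : IsHerglotzCarleson b M) (hb : AEStronglyMeasurable b) :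
    ∃ T : HerglotzSpace d →L[ℂ] HerglotzSpace d, ∀ u v, inner ℂ v (T u) = toeplitzForm b u v := by
  -- The form is linear in `u` and antilinear in `v`. Its conjugate has the variance expected by
  -- `continuousLinearMapOfBilin` and equals the inner product of `T u` with `v`.
  let B₀ : HerglotzSpace d →ₗ⋆[ℂ] HerglotzSpace d →ₗ[ℂ] ℂ :=
    LinearMap.mk₂'ₛₗ (starRingEnd ℂ) (RingHom.id ℂ) (fun u v => conj (toeplitzForm b u v))
      (fun u₁ u₂ v => by
        simp only [toeplitzForm]
        rw [← map_add, ← integral_add (h.integrable hb _ _) (h.integrable hb _ _)]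
        congr 2
        ext x
        rw [add_coe]
        ring)
      (fun c u v => by
        simp only [toeplitzForm, smul_eq_mul]
        rw [← map_mul, ← integral_const_mul]
        congr 2
        ext x
        rw [smul_coe]
        ring)
      (fun u v₁ v₂ => by
        simp only [toeplitzForm]
        rw [← map_add, ← integral_add (h.integrable hb _ _) (h.integrable hb _ _)]
        congr 2
        ext x
        rw [add_coe, map_add]
        ring)
      (fun c u v => by
        simp only [toeplitzForm, smul_eq_mul, RingHom.id_apply]
        rw [← Complex.conj_conj c, ← map_mul, ← integral_const_mul]
        congr 2
        ext x
        rw [smul_coe, Complex.conj_conj, map_mul]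
        ring)
  let B := B₀.mkContinuous₂ (2 * M) fun u v => by
    change ‖conj (toeplitzForm b u v)‖ ≤ _
    rw [RCLike.norm_conj]
    exact h.norm_toeplitzForm_le hb u v
  refine ⟨InnerProductSpace.continuousLinearMapOfBilin B, fun u v => ?_⟩
  rw [← inner_conj_symm, InnerProductSpace.continuousLinearMapOfBilin_apply]
  exact Complex.conj_conj _

lemma opNorm_le (h : IsHerglotzCarleson b M) (hb : AEStronglyMeasurable b)
    {T : HerglotzSpace d →L[ℂ] HerglotzSpace d}
    (hT : ∀ u v, inner ℂ v (T u) = toeplitzForm b u v) : ‖T‖ ≤ 2 * M := by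
  refine T.opNorm_le_bound (by positivity) fun u => ?_
  have h1 := h.norm_toeplitzForm_le hb u (T u)
  rw [← hT, inner_self_eq_norm_sq_to_K, norm_pow, RCLike.norm_ofReal, abs_norm, sq] at h1
  rcases (norm_nonneg (T u)).eq_or_lt with h0 | h0
  · rw [← h0]; positivity
  · exact le_of_mul_le_mul_right h1 h0

lemma isToeplitzOperator (h : IsHerglotzCarleson b M) (hb : AEStronglyMeasurable b)
    {T : HerglotzSpace d →L[ℂ] HerglotzSpace d}
    (hT : ∀ u v, inner ℂ v (T u) = toeplitzForm b u v) : IsToeplitzOperator b T :=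
  ⟨h.isBoundedToeplitzForm hb, fun u x => by rw [← inner_kernel, hT]⟩

end IsHerglotzCarleson

/-! ### Integrable symbols and compactness -/

/-- The kernels are uniformly bounded in norm, so `|u|` is bounded pointwise by a multiple of `‖u‖`.
-/
lemma exists_isHerglotzCarleson_of_integrable {d : ℕ} {b : RSpace d → ℂ} (hb : Integrable b) :
    ∃ M, IsHerglotzCarleson b M := by
  obtain ⟨C, hC⟩ := exists_enorm_apply_le d
  have hfin : ∫⁻ x, ‖b x‖ₑ ≠ ⊤ := hb.2.ne
  refine ⟨(∫⁻ x, ‖b x‖ₑ).toNNReal * C ^ 2, fun u => ?_⟩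
  push_cast
  rw [ENNReal.coe_toNNReal hfin, mul_assoc, ← mul_pow, ← lintegral_mul_const' _ _ (by finiteness)]
  refine lintegral_mono fun x => ?_
  gcongr
  exact hC u x

/-- The quotient by a closed subspace is a normed space, and the quotient map commutes with the
integral and kills the integrand. -/
lemma integral_mem_of_isClosed {X V : Type*} [MeasurableSpace X] {μ : Measure X}
    [NormedAddCommGroup V] [NormedSpace ℂ V] [CompleteSpace V] (K : Submodule ℂ V)
    (hK : IsClosed (K : Set V)) {P : X → V} (hP : Integrable P μ) (h : ∀ x, P x ∈ K) :
    ∫ x, P x ∂μ ∈ K := by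
  have := hK
  rw [← Submodule.Quotient.mk_eq_zero]
  change K.mkQL (∫ x, P x ∂μ) = 0
  rw [← K.mkQL.integral_comp_comm hP]
  refine integral_eq_zero_of_ae (Eventually.of_forall fun x => ?_)
  exact (Submodule.Quotient.mk_eq_zero K).2 (h x)

/-- Toeplitz operators with integrable symbols are compact. -/
lemma exists_isCompactOperator_of_integrable {d : ℕ} {b : RSpace d → ℂ} (hb : Integrable b) :
    ∃ T : HerglotzSpace d →L[ℂ] HerglotzSpace d, IsCompactOperator T ∧
      ∀ u v, inner ℂ v (T u) = toeplitzForm b u v := by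
  obtain ⟨C, hC⟩ := exists_norm_kernel_le d
  -- `P x` is the rank-one operator sending `u` to `u(x) κ_x`. It is norm-continuous and bounded in
  -- `x`, so an integrable symbol can be integrated against it in operator norm.
  set P : RSpace d → HerglotzSpace d →L[ℂ] HerglotzSpace d :=
    fun x => (innerSL ℂ (kernel x)).smulRight (kernel x) with hP
  have hPK : ∀ x, IsCompactOperator (P x) := fun x =>
    ((isCompactOperator_id (E := ℂ)).clm_comp
      (ContinuousLinearMap.toSpanSingleton ℂ (kernel x))).comp_clm (innerSL ℂ (kernel x))
  have hPc : Continuous P := by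
    have := continuous_kernel (d := d)
    fun_prop
  have hPb : ∀ x, ‖P x‖ ≤ C * C := fun x => by
    rw [hP, ContinuousLinearMap.norm_smulRight_apply, innerSL_apply_norm]
    gcongr <;> exact hC x
  have hint : Integrable fun x => b x • P x :=
    hb.smul_bdd (C * C) hPc.aestronglyMeasurable (Eventually.of_forall hPb)
  refine ⟨∫ x, b x • P x, integral_mem_of_isClosed
    (compactOperator (RingHom.id ℂ) (HerglotzSpace d) (HerglotzSpace d))
    isClosed_setOfPred_isCompactOperator hint fun x => (hPK x).smul (b x), fun u v => ?_⟩
  let L : (HerglotzSpace d →L[ℂ] HerglotzSpace d) →L[ℂ] ℂ :=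
    (innerSL ℂ v).comp (ContinuousLinearMap.apply ℂ (HerglotzSpace d) u)
  refine (L.integral_comp_comm hint).symm.trans ?_
  rw [toeplitzForm]
  refine integral_congr_ae (Eventually.of_forall fun x => ?_)
  change inner ℂ v (b x • (inner ℂ (kernel x) u • kernel x)) = _
  rw [inner_smul_right, inner_smul_right, inner_kernel, ← inner_conj_symm, inner_kernel]
  exact (mul_assoc _ _ _).symm

lemma integrable_truncatedSymbol {d : ℕ} {a : RSpace d → ℂ} (ha : LocallyIntegrable a) (R : ℝ) :
    Integrable (truncatedSymbol a R) :=
  (ha.integrableOn_isCompact (isCompact_closedBall 0 R)).integrable_indicator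
    measurableSet_closedBall

lemma toeplitzForm_sub {d : ℕ} {a b : RSpace d → ℂ} {u v : HerglotzSpace d}
    (ha : Integrable fun x => a x * u x * conj (v x))
    (hb : Integrable fun x => b x * u x * conj (v x)) :
    toeplitzForm (a - b) u v = toeplitzForm a u v - toeplitzForm b u v := by
  rw [toeplitzForm, toeplitzForm, toeplitzForm, ← integral_sub ha hb]
  congr 1
  ext x
  rw [Pi.sub_apply]
  ring

/-- The tails of a symbol dominated by a gauge are small. -/
lemma exists_enorm_sub_truncatedSymbol_le {d : ℕ} {φ : ℝ → ℝ} {a : RSpace d → ℂ}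
    (hao : a =o[cocompact (RSpace d) ⊓ ae volume] fun x => φ ‖x‖) {ε : NNReal} (hε : 0 < ε) :
    ∃ R₀ : ℝ, ∀ R, R₀ ≤ R → ∀ᵐ x : RSpace d,
      ‖(a - truncatedSymbol a R) x‖ₑ ≤ ε * ‖φ ‖x‖‖ₑ := by
  have h := hao.bound (c := ε) hε
  obtain ⟨s, hs, t, ht, hst⟩ := mem_inf_iff_superset.1 h
  obtain ⟨R₀, hR₀⟩ : ∃ R₀ : ℝ, sᶜ ⊆ closedBall 0 R₀ := by
    obtain ⟨K, hK, hKs⟩ := mem_cocompact.1 hs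
    obtain ⟨R₀, hR₀⟩ := hK.isBounded.subset_closedBall 0
    exact ⟨R₀, (Set.compl_subset_comm.1 hKs).trans hR₀⟩
  refine ⟨R₀, fun R hR => ?_⟩
  filter_upwards [ht] with x hx
  by_cases hxR : x ∈ closedBall (0 : RSpace d) R
  · simp [truncatedSymbol, Set.indicator_of_mem hxR]
  · have hxs : x ∈ s := by
      by_contra hxs
      exact hxR (closedBall_subset_closedBall hR (hR₀ hxs))
    have hx2 : ‖a x‖ ≤ ε * ‖φ ‖x‖‖ := hst ⟨hxs, hx⟩
    rw [Pi.sub_apply, truncatedSymbol, Set.indicator_of_notMem hxR, sub_zero]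
    have hx3 : ‖a x‖₊ ≤ ε * ‖φ ‖x‖‖₊ := hx2
    simp only [enorm_eq_nnnorm]
    exact_mod_cast hx3

theorem theorem8p7 (d : ℕ) (hd : 2 ≤ d) (φ : ℝ → ℝ) (hφ : IsAdmissibleRadialGauge d φ)
    (a : RSpace d → ℂ) (ha : LocallyIntegrable a)
    (hao : a =o[cocompact (RSpace d) ⊓ ae volume] fun x => φ ‖x‖) :
    ∃ T : HerglotzSpace d →L[ℂ] HerglotzSpace d,
      IsToeplitzOperator a T ∧
      IsCompactOperator T ∧
      ∃ S : ℝ → HerglotzSpace d →L[ℂ] HerglotzSpace d,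
        (∀ R : ℝ, IsToeplitzOperator (truncatedSymbol a R) (S R) ∧ IsCompactOperator (S R)) ∧
        Tendsto S atTop (𝓝 T) := by
  obtain ⟨C, hC⟩ := hφ.exists_lintegral_le hd
  have ham : AEStronglyMeasurable a := ha.aestronglyMeasurable
  have htr := integrable_truncatedSymbol ha
  have hsubm : ∀ R, AEStronglyMeasurable (a - truncatedSymbol a R) := fun R => ham.sub (htr R).1
  have htail : ∀ ε : NNReal, 0 < ε → ∃ R₀ : ℝ, ∀ R, R₀ ≤ R →
      IsHerglotzCarleson (a - truncatedSymbol a R) (ε * C) := by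
    intro ε hε
    obtain ⟨R₀, hR₀⟩ := exists_enorm_sub_truncatedSymbol_le hao hε
    refine ⟨R₀, fun R hR u => ?_⟩
    calc _ ≤ ∫⁻ x : RSpace d, ε * (‖φ ‖x‖‖ₑ * ‖u x‖ₑ ^ 2) := by
          refine lintegral_mono_ae ((hR₀ R hR).mono fun x hx => ?_)
          rw [← mul_assoc]
          gcongr
      _ = ε * ∫⁻ x : RSpace d, ‖φ ‖x‖‖ₑ * ‖u x‖ₑ ^ 2 := lintegral_const_mul' _ _ (by simp)
      _ ≤ ε * (C * ‖u‖ₑ ^ 2) := by gcongr; exact hC u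
      _ = _ := by push_cast; ring
  choose M hM using fun R => exists_isHerglotzCarleson_of_integrable (htr R)
  choose S hSc hS using fun R => exists_isCompactOperator_of_integrable (htr R)
  -- Any single tail bound suffices for boundedness: `a` is a tail dominated by the gauge plus an
  -- integrable truncation.
  obtain ⟨R₁, hR₁⟩ := htail 1 one_pos
  have hfull : IsHerglotzCarleson a (1 * C + M R₁) := fun u => by
    have hum := (HerglotzSpace.continuous_coe u).measurable
    have hm1 := (hsubm R₁).enorm
    calc _ ≤ ∫⁻ x : RSpace d, (‖(a - truncatedSymbol a R₁) x‖ₑ * ‖u x‖ₑ ^ 2 +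
          ‖truncatedSymbol a R₁ x‖ₑ * ‖u x‖ₑ ^ 2) := by
          refine lintegral_mono fun x => ?_
          rw [← add_mul]
          gcongr
          refine le_trans (le_of_eq ?_) (enorm_add_le _ _)
          rw [Pi.sub_apply, sub_add_cancel]
      _ = (∫⁻ x : RSpace d, ‖(a - truncatedSymbol a R₁) x‖ₑ * ‖u x‖ₑ ^ 2) +
          ∫⁻ x : RSpace d, ‖truncatedSymbol a R₁ x‖ₑ * ‖u x‖ₑ ^ 2 :=
          lintegral_add_left' (by fun_prop) _
      _ ≤ (1 * C : NNReal) * ‖u‖ₑ ^ 2 + M R₁ * ‖u‖ₑ ^ 2 :=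
          add_le_add (hR₁ R₁ le_rfl u) (hM R₁ u)
      _ = _ := by push_cast; ring
  obtain ⟨T, hT⟩ := hfull.exists_operator ham
  have hlim : Tendsto S atTop (𝓝 T) := by
    rw [Metric.tendsto_atTop]
    intro ε hε
    have hε' : 0 < ε / (4 * (C + 1)) := by positivity
    -- The tail operator has norm at most `2 * η * C ≤ ε / 2`; the `+ 1` covers `C = 0`.
    set η : NNReal := (ε / (4 * (C + 1))).toNNReal with hη
    have hη0 : 0 < η := Real.toNNReal_pos.2 hε'
    obtain ⟨R₀, hR₀⟩ := htail η hη0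
    refine ⟨R₀, fun R hR => ?_⟩
    have h1 := (hR₀ R hR).opNorm_le (hsubm R) (T := T - S R) fun u v => by
      rw [sub_apply, inner_sub_right, hT, hS,
        toeplitzForm_sub (hfull.integrable ham u v) ((hM R).integrable (htr R).1 u v)]
    rw [dist_comm, dist_eq_norm]
    refine h1.trans_lt ?_
    push_cast
    rw [hη, Real.coe_toNNReal _ hε'.le]
    have h2 : ε / (4 * (C + 1)) * (C + 1) = ε / 4 := by field_simp
    linarith
  refine ⟨T, hfull.isToeplitzOperator ham hT, ?_, S, fun R =>
    ⟨(hM R).isToeplitzOperator (htr R).1 (hS R), hSc R⟩, hlim⟩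
  exact isCompactOperator_of_tendsto hlim (Eventually.of_forall hSc)
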